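/- Let $G=(V,E)$ be a finite simple graph. For a colouring $\omega\colon V\to\{1,\dots,c\}$ (not necessarily proper), the monochromatic component of a vertex $v$ is the set of vertices joined to $v$ by a path of $G$ all of whose vertices have colour $\omega(v)$. A (free Flood-It) move $(v,d)$, with $v\in V$ and $d\in\{1,\dots,c\}$, gives colour $d$ to every vertex of the current monochromatic component of $v$ and changes no other vertex. Let $m(G,\omega,d)$ be the minimum number of moves, starting from $\omega$, after which all vertices of $G$ have colour $d$; let $m(G,\omega)=\min_{1\le d\le c} m(G,\omega,d)$, and let $$M_c(G)=\max_{\omega} m(G,\omega),$$ where $\omega$ ranges over all surjective functions $V\to\{1,\dots,c\}$. The graph $G$ is a blow-up of a graph $H$ if $V$ can be partitioned into non-empty sets $V_u$, one for each vertex $u$ of $H$, such that for all $v_1\in V_u$ and $v_2\in V_w$ the pair $v_1v_2$ is an edge of $G$ if and only if $uw$ is an edge of $H$. **Theorem.** Let $c\ge 1$ and $t\ge 2c^{10}$ be integers, and let $G$ be a finite graph that is a blow-up of the path on $t$ vertices or, with $t\ge 3$, of the cycle on $t$ vertices. Then $$M_c(G)=t-\left\lceil\frac{t}{c}\right\rceil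 .$$ -/

import Mathlib

namespace FloodIt

/-- `G` is a blow-up of `H`: the vertices of `G` are partitioned into non-empty classes
`π ⁻¹' {x}`, one for each vertex `x` of `H`, and two vertices of `G` are adjacent if and only if
their classes correspond to adjacent vertices of `H` (so each class is an independent set). -/
def IsBlowUp {V W : Type*} (G : SimpleGraph V) (H : SimpleGraph W) : Prop :=
  ∃ π : V → W, Function.Surjective π ∧ ∀ u v : V, G.Adj u v ↔ H.Adj (π u) (π v)

/-- The spanning subgraph of `G` that keeps the edges whose two ends have the same colour. -/
def monoGraph {V C : Type*} (G : SimpleGraph V) (ω : V → C) : SimpleGraph V where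
  Adj u w := G.Adj u w ∧ ω u = ω w
  symm := ⟨fun _ _ h => ⟨h.1.symm, h.2.symm⟩⟩
  loopless := ⟨fun _ h => G.irrefl h.1⟩

/-- The monochromatic component of the vertex `v` in `G` with respect to the colouring `ω`. -/
def monoComponent {V C : Type*} (G : SimpleGraph V) (ω : V → C) (v : V) : Set V :=
  {w | (monoGraph G ω).Reachable v w}

open Classical in
/-- The colouring after the (free) move `m = (v, d)`: every vertex of the monochromatic component
of `v` receives colour `d`, and all other vertices keep their colours. -/
noncomputable def playMove {V C : Type*} (G : SimpleGraph V) (ω : V → C) (m : V × C) : V → C :=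
  fun w => if w ∈ monoComponent G ω m.1 then m.2 else ω w

/-- The colouring after playing a finite sequence of moves, from left to right. -/
noncomputable def playMoves {V C : Type*} (G : SimpleGraph V) (ω : V → C) (S : List (V × C)) :
    V → C :=
  S.foldl (playMove G) ω

/-- `m(G, ω, d)`: the minimum number of moves that give all vertices of `G` colour `d`
(`⊤` if there is no such sequence of moves). -/
noncomputable def movesToColour {V C : Type*} (G : SimpleGraph V) (ω : V → C) (d : C) : ℕ∞ :=
  ⨅ S ∈ {S : List (V × C) | ∀ v : V, playMoves G ω S v = d}, (S.length : ℕ∞)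

/-- `m(G, ω)`: the minimum number of moves that make `G` monochromatic. -/
noncomputable def minMoves {V C : Type*} (G : SimpleGraph V) (ω : V → C) : ℕ∞ :=
  ⨅ d : C, movesToColour G ω d

/-- `M_c(G)`: the maximum of `m(G, ω)` over all surjective colourings `ω` of the vertices of `G`
with `c` colours. -/
noncomputable def maxMoves {V : Type*} (c : ℕ) (G : SimpleGraph V) : ℕ∞ :=
  ⨆ ω : {ω : V → Fin c // Function.Surjective ω}, minMoves G ω.1

/-- On a finite graph that has a surjective `c`-colouring, the supremum in `maxMoves` is attained,
so that it is a maximum. -/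
theorem isGreatest_maxMoves {V : Type*} [Finite V] (c : ℕ) (G : SimpleGraph V)
    (h : ∃ ω : V → Fin c, Function.Surjective ω) :
    IsGreatest {k : ℕ∞ | ∃ ω : V → Fin c, Function.Surjective ω ∧ minMoves G ω = k}
      (maxMoves c G) := by
  obtain ⟨ω₀, h₀⟩ := h
  have : Nonempty {ω : V → Fin c // Function.Surjective ω} := ⟨⟨ω₀, h₀⟩⟩
  constructor
  · obtain ⟨ω, hω⟩ := exists_eq_ciSup_of_finite
      (f := fun ω : {ω : V → Fin c // Function.Surjective ω} => minMoves G ω.1)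
    exact ⟨ω.1, ω.2, hω⟩
  · rintro k ⟨ω, hs, rfl⟩
    exact le_iSup (fun ω : {ω : V → Fin c // Function.Surjective ω} => minMoves G ω.1) ⟨ω, hs⟩

end FloodIt

namespace FloodIt

/-! ### Flooding: components, repeated moves at one vertex, painting in one colour. -/

section Moves

variable {V C : Type*} {G : SimpleGraph V} {ω : V → C} {v w k : V} {d : C}

/-! Both the path and the cycle case are handled by arranging the vertices in `t` cyclic layers
(`Layered`), and everything reduces to noncrossing partitions of the layers.

Lower bound: colour layer `i` by `i % c`. Undoing the moves one at a time turns a solution with `k`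
moves into a noncrossing labelling with at most `k + 1` labels in which equally labelled layers
share a colour (`Layered.exists_labelling`). Here equal labels force congruence modulo `c`, so a
first-return induction (`le_card_image_add`) gives at least `t - ⌊(t - 1) / c⌋` labels.

Upper bound: choose one colour occurring in each layer. A noncrossing partition into single-coloured
blocks with `s` merges gives all layers a common colour in `t - s - 1` moves
(`Layered.exists_common_colour`); the resulting component dominates the graph, and `c - 1` further
moves finish. Pigeonhole yields about `t / c` merges, so the cost of the last `c - 1` moves must be
earned by extra merges. Scan windows of `3 * c` layers (`exists_arcs_or_rainbow`): each either
improves the count by `1 / c` of a merge, or is rigid, with single-coloured layers and any `c`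
consecutive ones of distinct colours. After `c ^ 2` gains the partition suffices.

In a rigid window the final clean-up is free: sweeping a component through `c` rainbow layers plays
every colour, so leftover vertices next to it are absorbed on the way (`Layered.exists_clean`). On a
cycle one sweep around suffices; on a path two sweeps from the ends meet in a layer whose index is a
multiple of `c`, so that rounding loses nothing. -/

theorem mem_monoComponent_self : v ∈ monoComponent G ω v :=
  SimpleGraph.Reachable.refl v

theorem mem_monoComponent_trans (h : w ∈ monoComponent G ω v) (h' : k ∈ monoComponent G ω w) :
    k ∈ monoComponent G ω v :=
  SimpleGraph.Reachable.trans h h'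

theorem monoComponent_induction {P : V → Prop} (h0 : P v)
    (hs : ∀ a b, a ∈ monoComponent G ω v → b ∈ monoComponent G ω v → G.Adj a b → ω a = ω b →
      P a → P b)
    (h : w ∈ monoComponent G ω v) : P w := by
  have h' : Relation.ReflTransGen (monoGraph G ω).Adj v w :=
    (SimpleGraph.reachable_iff_reflTransGen v w).1 h
  induction h' with
  | refl => exact h0
  | @tail a b hab hb ih =>
    have ha : a ∈ monoComponent G ω v := (SimpleGraph.reachable_iff_reflTransGen v a).2 hab
    exact hs a b ha h hb.1 hb.2 (ih ha)

theorem color_of_mem (h : w ∈ monoComponent G ω v) : ω w = ω v :=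
  monoComponent_induction (P := fun w => ω w = ω v) rfl
    (fun _ _ _ _ _ h1 h2 => h1.symm.trans h2) h

theorem mem_of_adj (h : k ∈ monoComponent G ω v) (ha : G.Adj k w) (hc : ω w = ω v) :
    w ∈ monoComponent G ω v :=
  mem_monoComponent_trans h
    (SimpleGraph.Adj.reachable (G := monoGraph G ω) ⟨ha, (color_of_mem h).trans hc.symm⟩)

theorem playMove_of_mem (h : w ∈ monoComponent G ω v) : playMove G ω (v, d) w = d := by
  simp [playMove, h]

theorem playMove_of_notMem (h : w ∉ monoComponent G ω v) : playMove G ω (v, d) w = ω w := by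
  simp [playMove, h]

theorem playMove_eq_or : playMove G ω (v, d) w = d ∨ playMove G ω (v, d) w = ω w := by
  by_cases h : w ∈ monoComponent G ω v
  · exact Or.inl (playMove_of_mem h)
  · exact Or.inr (playMove_of_notMem h)

theorem playMove_of_color_eq (h : ω w = d) : playMove G ω (v, d) w = d := by
  rcases playMove_eq_or (G := G) (ω := ω) (v := v) (w := w) (d := d) with h' | h'
  · exact h'
  · rw [h', h]

theorem playMove_self (h : ω v = d) : playMove G ω (v, d) w = ω w := by
  by_cases hw : w ∈ monoComponent G ω v
  · rw [playMove_of_mem hw, color_of_mem hw, h]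
  · exact playMove_of_notMem hw

theorem playMove_root : playMove G ω (v, d) v = d := playMove_of_mem mem_monoComponent_self

theorem mem_playMove (h : w ∈ monoComponent G ω v) :
    w ∈ monoComponent G (playMove G ω (v, d)) v :=
  monoComponent_induction (P := fun w => w ∈ monoComponent G (playMove G ω (v, d)) v)
    mem_monoComponent_self
    (fun a b _ hb hab _ h => mem_of_adj h hab (by rw [playMove_of_mem hb, playMove_root])) h

theorem mem_playMove_of_color (hk : ω k = d) (h : w ∈ monoComponent G ω k) :
    w ∈ monoComponent G (playMove G ω (v, d)) k :=
  monoComponent_induction (P := fun w => w ∈ monoComponent G (playMove G ω (v, d)) k)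
    mem_monoComponent_self
    (fun a b _ hb hab _ h => mem_of_adj h hab (by
      rw [playMove_of_color_eq ((color_of_mem hb).trans hk), playMove_of_color_eq hk])) h

theorem mem_playMove_of_adj (h : k ∈ monoComponent G ω v) (ha : G.Adj k w) (hc : ω w = d) :
    w ∈ monoComponent G (playMove G ω (v, d)) v :=
  mem_of_adj (mem_playMove h) ha (by rw [playMove_of_color_eq hc, playMove_root])

/-- The colouring obtained by playing at the vertex `v` the colours of a list. -/
noncomputable def playAt (G : SimpleGraph V) (ω : V → C) (v : V) (L : List C) : V → C :=
  playMoves G ω (L.map fun d => (v, d))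

/-- The colouring obtained by playing the colour `d` at the vertices of a list. -/
noncomputable def playColour (G : SimpleGraph V) (ω : V → C) (d : C) (L : List V) : V → C :=
  playMoves G ω (L.map fun v => (v, d))

theorem playMoves_append (S T : List (V × C)) :
    playMoves G ω (S ++ T) = playMoves G (playMoves G ω S) T := by
  simp [playMoves]

theorem playAt_concat (L : List C) :
    playAt G ω v (L ++ [d]) = playMove G (playAt G ω v L) (v, d) := by
  simp [playAt, playMoves]

theorem playColour_cons (L : List V) :
    playColour G ω d (v :: L) = playColour G (playMove G ω (v, d)) d L := rfl

theorem mem_playAt (L : List C) (h : w ∈ monoComponent G ω v) :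
    w ∈ monoComponent G (playAt G ω v L) v := by
  induction L generalizing ω with
  | nil => exact h
  | cons d L ih => exact ih (mem_playMove h)

theorem mem_playAt_or (L : List C) :
    w ∈ monoComponent G (playAt G ω v L) v ∨ playAt G ω v L w = ω w := by
  induction L generalizing ω with
  | nil => exact Or.inr rfl
  | cons d L ih =>
    by_cases h : w ∈ monoComponent G ω v
    · exact Or.inl (mem_playAt (d :: L) h)
    · rcases ih (ω := playMove G ω (v, d)) with h' | h'
      · exact Or.inl h'
      · exact Or.inr (h'.trans (playMove_of_notMem h))

/-- The component of `v` only grows and stays adjacent to `w`, while `w` keeps its colour until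
absorbed, which happens at the latest when that colour is played. -/
theorem mem_playAt_of_adj (L : List C) (hk : k ∈ monoComponent G ω v) (ha : G.Adj k w)
    (hw : ω w = ω v ∨ ω w ∈ L) : w ∈ monoComponent G (playAt G ω v L) v := by
  induction L generalizing ω with
  | nil => exact mem_of_adj hk ha (hw.resolve_right (by simp))
  | cons d L ih =>
    by_cases h : w ∈ monoComponent G ω v
    · exact mem_playAt (d :: L) h
    · have h1 : ω w ≠ ω v := fun e => h (mem_of_adj hk ha e)
      rcases hw.resolve_left h1 with - | ⟨_, hL⟩
      · exact mem_playAt L (mem_playMove_of_adj hk ha rfl)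
      · exact ih (mem_playMove hk) (Or.inr (by rwa [playMove_of_notMem h]))

theorem playColour_of_color_eq (L : List V) (h : ω w = d) : playColour G ω d L w = d := by
  induction L generalizing ω with
  | nil => exact h
  | cons v L ih => exact ih (playMove_of_color_eq h)

theorem mem_playColour_of_color (L : List V) (hk : ω k = d) (h : w ∈ monoComponent G ω k) :
    w ∈ monoComponent G (playColour G ω d L) k := by
  induction L generalizing ω with
  | nil => exact h
  | cons v L ih => exact ih (playMove_of_color_eq hk) (mem_playMove_of_color hk h)

theorem playColour_of_mem (L : List V) (h : w ∈ L) : playColour G ω d L w = d := by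
  induction L generalizing ω with
  | nil => cases h
  | cons v L ih =>
    rcases List.mem_cons.1 h with rfl | h
    · exact playColour_of_color_eq L playMove_root
    · exact ih h

/-- Vertices of colour `d` are never recoloured, so a vertex painted together with `k` stays
connected to `k`. -/
theorem playColour_eq_or (L : List V) : playColour G ω d L w = ω w ∨
    ∃ k ∈ L, w ∈ monoComponent G (playColour G ω d L) k := by
  induction L generalizing ω with
  | nil => exact Or.inl rfl
  | cons v L ih =>
    by_cases h : w ∈ monoComponent G ω v
    · exact Or.inr ⟨v, by simp, mem_playColour_of_color L playMove_root (mem_playMove h)⟩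
    · rcases ih (ω := playMove G ω (v, d)) with h' | ⟨k, hk, h'⟩
      · exact Or.inl (h'.trans (playMove_of_notMem h))
      · exact Or.inr ⟨k, by simp [hk], h'⟩

theorem minMoves_le (S : List (V × C)) (hS : ∀ w, playMoves G ω S w = d) :
    minMoves G ω ≤ S.length :=
  (iInf_le _ d).trans (iInf₂_le (f := fun (S : List (V × C)) _ => (S.length : ℕ∞)) S hS)

theorem le_minMoves {n : ℕ}
    (h : ∀ (S : List (V × C)) (d : C), (∀ w, playMoves G ω S w = d) → n ≤ S.length) :
    (n : ℕ∞) ≤ minMoves G ω :=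
  le_iInf fun d => le_iInf₂ fun S hS => by exact_mod_cast h S d hS

end Moves

/-! ### Layered graphs, covering blow-ups of paths and of cycles -/

section Layers

/-- `π` arranges the vertices of `G` in `t` non-empty layers such that consecutive layers are
completely joined, and all edges join layers that are consecutive in the cyclic order. -/
structure Layered {V : Type*} (G : SimpleGraph V) (t : ℕ) (π : V → ℕ) : Prop where
  lt : ∀ v, π v < t
  surj : ∀ i < t, ∃ v, π v = i
  adj : ∀ u v, π v = π u + 1 → G.Adj u v
  cyc : ∀ u v, G.Adj u v → π v = π u + 1 ∨ π u = π v + 1 ∨ (π u = 0 ∧ π v + 1 = t) ∨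
    (π v = 0 ∧ π u + 1 = t)

variable {V C : Type*} {G : SimpleGraph V} {ω : V → C} {t : ℕ} {π : V → ℕ}

/-- Consecutive layers that contain vertices of the same colour are connected. -/
theorem Layered.mem_monoComponent (hπ : Layered G t π) {l r : ℕ} (g : ℕ → V)
    (hg : ∀ i, l ≤ i → i ≤ r → π (g i) = i) (hc : ∀ i, l ≤ i → i ≤ r → ω (g i) = ω (g l))
    {i : ℕ} (hl : l ≤ i) (hr : i ≤ r) : g i ∈ monoComponent G ω (g l) := by
  induction i, hl using Nat.le_induction with
  | base => exact mem_monoComponent_self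
  | succ i hi ih =>
    refine mem_of_adj (ih (by omega)) (hπ.adj _ _ ?_) (hc _ (by omega) hr)
    rw [hg _ (by omega) hr, hg _ hi (by omega)]

/-- If the component of `v` meets the layer `r`, then playing the colours of the single-coloured
layers `r + 1, …, r + m` absorbs these layers. -/
theorem Layered.mem_playAt_layers (hπ : Layered G t π) {v : V} {r : ℕ} (x : ℕ → C)
    (hr : ∃ k ∈ monoComponent G ω v, π k = r) (m : ℕ) (hm : r + m < t)
    (hx : ∀ w, r < π w → π w ≤ r + m → w ∈ monoComponent G ω v ∨ ω w = x (π w))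
    {w : V} (h1 : r < π w) (h2 : π w ≤ r + m) :
    w ∈ monoComponent G (playAt G ω v ((List.range m).map fun i => x (r + 1 + i))) v := by
  induction m generalizing w with
  | zero => omega
  | succ m ih =>
    have ih' := fun w => @ih (by omega) (fun w a b => hx w a (by omega)) w
    rw [List.range_succ, List.map_append, List.map_singleton, playAt_concat]
    by_cases hw : π w ≤ r + m
    · exact mem_playMove (ih' w h1 hw)
    · have hw' : π w = r + m + 1 := by omega
      rcases mem_playAt_or (G := G) (ω := ω) (v := v) (w := w)
        ((List.range m).map fun i => x (r + 1 + i)) with h | h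
      · exact mem_playMove h
      · have hk : ∃ k ∈ monoComponent G
            (playAt G ω v ((List.range m).map fun i => x (r + 1 + i))) v, π k = r + m := by
          rcases Nat.eq_zero_or_pos m with rfl | hm0
          · obtain ⟨k, hk, e⟩ := hr
            exact ⟨k, mem_playAt _ hk, e⟩
          · obtain ⟨k, hk⟩ := hπ.surj (r + m) (by omega)
            exact ⟨k, ih' k (by omega) (by omega), hk⟩
        obtain ⟨k, hk, e⟩ := hk
        rcases hx w h1 h2 with h3 | h3
        · exact mem_playMove (mem_playAt _ h3)
        · refine mem_playMove_of_adj hk (hπ.adj _ _ (by omega)) ?_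
          rw [h, h3, hw']
          congr 1
          omega

/-- Along a path, playing the colours of the layers `r + 1, …, r + m` at a component that has the
colour of the layer `r` changes only vertices below the layer `r + m`. -/
theorem playAt_layers_of_le (hp : ∀ u v, G.Adj u v → π v ≤ π u + 1) {v : V} {ω' : V → C} {r : ℕ}
    (x : ℕ → C) (m : ℕ) (hv : π v ≤ r) (hc : ω' v = x r) (h0 : ∀ w, r ≤ π w → ω' w = ω w)
    (hx : ∀ w, r ≤ π w → π w ≤ r + m → ω w = x (π w))
    (hne : ∀ i, r ≤ i → i < r + m → x i ≠ x (i + 1)) :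
    playAt G ω' v ((List.range m).map fun i => x (r + 1 + i)) v = x (r + m) ∧
      ∀ w, r + m ≤ π w →
        playAt G ω' v ((List.range m).map fun i => x (r + 1 + i)) w = ω w := by
  induction m with
  | zero => exact ⟨hc, h0⟩
  | succ m ih =>
    obtain ⟨i1, i2⟩ := ih (fun w a b => hx w a (by omega)) (fun i a b => hne i a (by omega))
    rw [List.range_succ, List.map_append, List.map_singleton, playAt_concat]
    refine ⟨by rw [playMove_root]; congr 1; omega, fun w hw => ?_⟩
    rw [playMove_of_notMem, i2 w (by omega)]
    intro hmem
    have : π w ≤ r + m := by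
      refine monoComponent_induction (P := fun w => π w ≤ r + m) (by omega) ?_ hmem
      intro a b _ hb hab _ ha
      by_contra hcon
      have h3 := hp a b hab
      have hb' : π b = r + m + 1 := by omega
      have h4 := color_of_mem hb
      rw [i2 b (by omega), i1, hx b (by omega) (by omega), hb'] at h4
      exact hne (r + m) (by omega) (by omega) h4.symm
    omega

/-- Along a path, playing the colour `d` below a layer of colour `z` changes only vertices below
this layer if the preceding layer does not contain the colour `z`. -/
theorem playColour_of_le (hp : ∀ u v, G.Adj u v → π v ≤ π u + 1) {r : ℕ} {z d : C} (L : List V)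
    (hL : ∀ v ∈ L, π v < r) (hz : ∀ w, π w = r → ω w = z)
    (hz' : d = z ∨ ∀ w, π w + 1 = r → ω w ≠ z) :
    ∀ w, r ≤ π w → playColour G ω d L w = ω w := by
  induction L generalizing ω with
  | nil => exact fun w _ => rfl
  | cons v L ih =>
    have key : ∀ w, r ≤ π w → playMove G ω (v, d) w = ω w := by
      intro w hw
      by_cases hv : ω v = d
      · exact playMove_self hv
      refine playMove_of_notMem fun hmem => ?_
      have : π w < r := by
        refine monoComponent_induction (P := fun w => π w < r) (hL v (by simp)) ?_ hmem
        intro a b ha hb hab _ har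
        by_contra hcon
        have h3 := hp a b hab
        have h4 := hz b (by omega)
        have h5 := color_of_mem hb
        have h6 := color_of_mem ha
        -- A component that reaches layer `r` from below has colour `z`. Then either the move is
        -- trivial because `d = z`, or the crossing edge starts in layer `r - 1` at a vertex of
        -- colour `z`.
        rcases hz' with rfl | hz'
        · exact hv (h5.symm.trans h4)
        · exact hz' a (by omega) (h6.trans (h5.symm.trans h4))
      omega
    intro w hw
    rw [playColour_cons, ih (fun v hv => hL v (by simp [hv])) (fun w h => by
      rw [key w (by omega), hz w h]) _ w hw, key w hw]
    by_cases hdz : d = z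
    · exact Or.inl hdz
    · refine Or.inr fun w h => ?_
      rcases playMove_eq_or (G := G) (ω := ω) (v := v) (w := w) (d := d) with h' | h'
      · rwa [h']
      · rw [h']
        exact hz'.resolve_left hdz w h

end Layers

/-! ### Cleaning an initial segment by a sweep through rainbow layers -/

section Clean

variable {V : Type*} {G : SimpleGraph V} {t c : ℕ} {ω : V → Fin c} {π : V → ℕ}

theorem exists_le_mul_card_fiber {ι : Type*} (s : Finset ι) (h : ι → Fin c) (hs : s.Nonempty) :
    ∃ d, s.card ≤ c * (s.filter fun i => h i = d).card := by
  by_contra! hcon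
  have h1 : s.card = ∑ d : Fin c, (s.filter fun i => h i = d).card :=
    Finset.card_eq_sum_card_fiberwise (fun _ _ => Finset.mem_coe.2 (Finset.mem_univ _))
  have hc : 0 < c := by
    obtain ⟨i, -⟩ := hs
    exact (h i).pos
  have h2 : ∑ d : Fin c, c * (s.filter fun i => h i = d).card < ∑ d : Fin c, s.card :=
    Finset.sum_lt_sum_of_nonempty ⟨⟨0, hc⟩, Finset.mem_univ _⟩ fun d _ => hcon d
  rw [← Finset.mul_sum, ← h1] at h2
  simp at h2

/-- Some component can be made to meet all layers `1, …, r` and to have the colour of the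
single-coloured layer `r` in `r - ⌈r / c⌉` moves. -/
theorem Layered.exists_link (hπ : Layered G t π) {r : ℕ} (hr : 2 ≤ r) (hrt : r < t) {z : Fin c}
    (hz : ∀ w, π w = r → ω w = z) :
    ∃ (S : List (V × Fin c)) (n : ℕ) (v : V), S.length + n = r ∧ r ≤ c * n ∧ π v ≤ r ∧
      playMoves G ω S v = z ∧
      (∀ i, 1 ≤ i → i ≤ r → ∃ k ∈ monoComponent G (playMoves G ω S) v, π k = i) ∧
      (∀ w, w ∈ monoComponent G (playMoves G ω S) v ∨ playMoves G ω S w = ω w) ∧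
      ((∀ u v, G.Adj u v → π v ≤ π u + 1) → (∀ w, π w + 1 = r → ω w ≠ z) →
        ∀ w, r ≤ π w → playMoves G ω S w = ω w) := by
  obtain ⟨g, hg⟩ : ∃ g : ℕ → V, ∀ i < t, π (g i) = i := by
    obtain ⟨v0, -⟩ := hπ.surj r hrt
    refine ⟨fun i => if h : i < t then (hπ.surj i h).choose else v0, fun i h => ?_⟩
    simp only [h, dif_pos]
    exact (hπ.surj i h).choose_spec
  -- `d` is a most frequent colour among the representatives of layers `1, …, r`. Painting the other
  -- representatives below layer `r` joins layers `1, …, r - 1`.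
  obtain ⟨d, hd⟩ := exists_le_mul_card_fiber (Finset.Icc 1 r) (fun i => ω (g i))
    ⟨1, by simp; omega⟩
  set n := ((Finset.Icc 1 r).filter fun i => ω (g i) = d).card with hn
  simp only [Nat.card_Icc, Nat.add_sub_cancel] at hd
  set F := (Finset.Icc 1 (r - 1)).filter fun i => ω (g i) ≠ d with hF
  set L := F.toList.map g with hL
  have hLlen : L.length = F.card := by simp [hL]
  have hmemL : ∀ v ∈ L, ∃ i, 1 ≤ i ∧ i < r ∧ v = g i := by
    intro v hv
    simp only [hL, hF, List.mem_map, Finset.mem_toList, Finset.mem_filter, Finset.mem_Icc] at hv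
    obtain ⟨i, hi, rfl⟩ := hv
    exact ⟨i, by omega, by omega, rfl⟩
  have hsplit : ((Finset.Icc 1 (r - 1)).filter fun i => ω (g i) = d).card + F.card = r - 1 := by
    rw [hF, Finset.card_filter_add_card_filter_not]
    simp
  have hIcc : Finset.Icc 1 r = insert r (Finset.Icc 1 (r - 1)) := by
    ext i
    simp only [Finset.mem_Icc, Finset.mem_insert]
    omega
  have hgr : ω (g r) = z := hz _ (hg r hrt)
  set ω₁ := playColour G ω d L with hω₁
  have hcol : ∀ i, 1 ≤ i → i < r → ω₁ (g i) = d := by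
    intro i h1 h2
    by_cases h : ω (g i) = d
    · exact playColour_of_color_eq L h
    · refine playColour_of_mem L ?_
      simp only [hL, hF, List.mem_map, Finset.mem_toList, Finset.mem_filter, Finset.mem_Icc]
      exact ⟨i, ⟨by omega, h⟩, rfl⟩
  have hcon : ∀ i, 1 ≤ i → i < r → g i ∈ monoComponent G ω₁ (g 1) := fun i h1 h2 =>
    hπ.mem_monoComponent (l := 1) (r := r - 1) g (fun j _ _ => hg j (by omega))
      (fun j h3 h4 => by rw [hcol j h3 (by omega), hcol 1 le_rfl (by omega)]) h1 (by omega)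
  have hch : ∀ w, w ∈ monoComponent G ω₁ (g 1) ∨ ω₁ w = ω w := by
    intro w
    rcases playColour_eq_or (G := G) (ω := ω) (d := d) (w := w) L with h | ⟨k, hk, h⟩
    · exact Or.inr h
    · obtain ⟨i, h1, h2, rfl⟩ := hmemL k hk
      exact Or.inl (mem_monoComponent_trans (hcon i h1 h2) h)
  have hpath : (∀ u v, G.Adj u v → π v ≤ π u + 1) → (∀ w, π w + 1 = r → ω w ≠ z) →
      ∀ w, r ≤ π w → ω₁ w = ω w := fun hp hz' =>
    playColour_of_le hp L (fun v hv => by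
      obtain ⟨i, h1, h2, rfl⟩ := hmemL v hv
      rwa [hg i (by omega)]) hz (Or.inr hz')
  have hπ1 : π (g 1) = 1 := hg 1 (by omega)
  -- If `d = z`, layer `r` joins for free and is counted in `n`. Otherwise it is not counted, and
  -- one extra move to `z` reaches it. Both cases cost `r - n` moves.
  by_cases hdz : d = z
  · have hn' : n = ((Finset.Icc 1 (r - 1)).filter fun i => ω (g i) = d).card + 1 := by
      rw [hn, hIcc, Finset.filter_insert, if_pos (hgr.trans hdz.symm), Finset.card_insert_of_notMem]
      simp
      omega
    refine ⟨L.map fun v => (v, d), n, g 1, by simp only [List.length_map, hLlen]; omega, hd,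
      by omega, (hcol 1 le_rfl (by omega)).trans hdz, ?_, hch, hpath⟩
    intro i h1 h2
    refine ⟨g i, ?_, hg i (by omega)⟩
    rcases Nat.lt_or_ge i r with h3 | h3
    · exact hcon i h1 h3
    · obtain rfl : i = r := by omega
      refine mem_of_adj (hcon (i - 1) (by omega) (by omega)) (hπ.adj _ _ ?_) ?_
      · rw [hg _ hrt, hg _ (by omega)]
        omega
      · exact (playColour_of_color_eq L (hgr.trans hdz.symm)).trans (hcol 1 le_rfl (by omega)).symm
  · have hn' : n = ((Finset.Icc 1 (r - 1)).filter fun i => ω (g i) = d).card := by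
      rw [hn, hIcc, Finset.filter_insert, if_neg (fun h => hdz (h.symm.trans hgr))]
    have hplay : playMoves G ω ((L.map fun v => (v, d)) ++ [(g 1, z)]) =
        playMove G ω₁ (g 1, z) := by
      rw [playMoves_append]
      rfl
    refine ⟨(L.map fun v => (v, d)) ++ [(g 1, z)], n, g 1, ?_, hd, by omega, ?_⟩
    · simp only [List.length_append, List.length_map, hLlen, List.length_singleton]
      omega
    rw [hplay]
    refine ⟨playMove_root, ?_, ?_, ?_⟩
    · intro i h1 h2
      refine ⟨g i, ?_, hg i (by omega)⟩
      rcases Nat.lt_or_ge i r with h3 | h3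
      · exact mem_playMove (hcon i h1 h3)
      · obtain rfl : i = r := by omega
        rcases hch (g i) with h | h
        · exact mem_playMove h
        · refine mem_playMove_of_adj (hcon (i - 1) (by omega) (by omega)) (hπ.adj _ _ ?_)
            (h.trans hgr)
          rw [hg _ hrt, hg _ (by omega)]
          omega
    · intro w
      by_cases h : w ∈ monoComponent G ω₁ (g 1)
      · exact Or.inl (mem_playMove h)
      · exact Or.inr ((playMove_of_notMem h).trans ((hch w).resolve_left h))
    · intro hp hz' w hw
      have h1 := hpath hp hz'
      rw [playMove_of_notMem, h1 w hw]
      intro hmem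
      have : π w < r := by
        refine monoComponent_induction (P := fun w => π w < r) (by omega) ?_ hmem
        intro a b _ hb hab _ ha
        by_contra hcon
        have h3 := hp a b hab
        have h4 := color_of_mem hb
        rw [h1 b (by omega), hz b (by omega), hcol 1 le_rfl (by omega)] at h4
        exact hdz h4.symm
      omega

theorem exists_eq_of_injOn_Icc {x : ℕ → Fin c} {r m : ℕ} (hm : m + 1 = c)
    (hinj : ∀ i j, r ≤ i → i < j → j ≤ r + m → x i ≠ x j) (d : Fin c) :
    ∃ i, r ≤ i ∧ i ≤ r + m ∧ x i = d := by
  have h1 : Set.InjOn x (Finset.Icc r (r + m) : Finset ℕ) := by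
    intro i hi j hj hij
    simp only [Finset.coe_Icc, Set.mem_Icc] at hi hj
    by_contra hne
    rcases Nat.lt_or_gt_of_ne hne with h | h
    · exact hinj i j hi.1 h hj.2 hij
    · exact hinj j i hj.1 h hi.2 hij.symm
  have h2 : (Finset.Icc r (r + m)).image x = Finset.univ := by
    apply Finset.eq_univ_of_card
    rw [Finset.card_image_of_injOn h1, Nat.card_Icc, Fintype.card_fin]
    omega
  have h3 : d ∈ (Finset.Icc r (r + m)).image x := h2 ▸ Finset.mem_univ d
  obtain ⟨i, hi, rfl⟩ := Finset.mem_image.1 h3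
  exact ⟨i, (Finset.mem_Icc.1 hi).1, (Finset.mem_Icc.1 hi).2, rfl⟩

/-- If the layers `r, …, r + c - 1` are single-coloured with distinct colours, then the layers up
to the last of these can be made monochromatic in few moves. -/
theorem Layered.exists_clean (hπ : Layered G t π) {r m : ℕ} (hm : m + 1 = c) (hm1 : 1 ≤ m)
    (hr : 2 ≤ r) (hrt : r + m < t) {x : ℕ → Fin c}
    (hx : ∀ w, r ≤ π w → π w ≤ r + m → ω w = x (π w))
    (hinj : ∀ i j, r ≤ i → i < j → j ≤ r + m → x i ≠ x j) :
    ∃ (S : List (V × Fin c)) (n : ℕ), S.length + n = r + m ∧ r ≤ c * n ∧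
      (∀ w, playMoves G ω S w = x (r + m) ∨ playMoves G ω S w = ω w) ∧
      (∀ w, π w ≤ r + m → playMoves G ω S w = x (r + m)) ∧
      ((∀ u v, G.Adj u v → π v ≤ π u + 1) → (∀ w, π w + 1 = r → ω w ≠ x r) →
        ∀ w, r + m ≤ π w → playMoves G ω S w = ω w) := by
  obtain ⟨S, n, v, h1, h2, hv, h3, h4, h5, h6⟩ := hπ.exists_link (ω := ω) hr (by omega)
    (z := x r) (fun w hw => by rw [hx w (by omega) (by omega), hw])
  set ω₁ := playMoves G ω S
  set L := (List.range m).map fun i => x (r + 1 + i) with hL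
  have hplay : playMoves G ω (S ++ L.map fun d => (v, d)) = playAt G ω₁ v L := by
    rw [playMoves_append]
    rfl
  have hroot : playAt G ω₁ v L v = x (r + m) := by
    obtain ⟨m, rfl⟩ : ∃ m', m = m' + 1 := ⟨m - 1, by omega⟩
    rw [hL, List.range_succ, List.map_append, List.map_singleton, playAt_concat, playMove_root]
    congr 1
    omega
  refine ⟨S ++ L.map fun d => (v, d), n, ?_, h2, ?_⟩
  · simp only [List.length_append, List.length_map, hL, List.length_range]
    omega
  rw [hplay]
  refine ⟨fun w => ?_, fun w hw => ?_, fun hp hz => ?_⟩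
  · rcases mem_playAt_or (G := G) (ω := ω₁) (v := v) (w := w) L with h | h
    · exact Or.inl ((color_of_mem h).trans hroot)
    · rcases h5 w with h' | h'
      · exact Or.inl ((color_of_mem (mem_playAt L h')).trans hroot)
      · exact Or.inr (h.trans h')
  · refine (color_of_mem (G := G) ?_).trans hroot
    rcases Nat.lt_or_ge r (π w) with hrw | hrw
    · exact hπ.mem_playAt_layers x (h4 r (by omega) le_rfl) m hrt
        (fun w h h' => (h5 w).imp_right fun e => e.trans (hx w h.le h')) hrw hw
    -- Each vertex of layers `0, …, r` has a neighbour in the component, layer `0` through layer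
    -- `1`. The current colour `x r` and the colours in `L` exhaust all `c` colours, so the sweep
    -- absorbs it.
    · have hk : ∃ k ∈ monoComponent G ω₁ v, G.Adj k w := by
        rcases Nat.lt_or_ge (π w) r with h | h
        · obtain ⟨k, hk, e⟩ := h4 (π w + 1) (by omega) (by omega)
          exact ⟨k, hk, (hπ.adj _ _ e).symm⟩
        · obtain ⟨k, hk, e⟩ := h4 (r - 1) (by omega) (by omega)
          exact ⟨k, hk, hπ.adj _ _ (by omega)⟩
      obtain ⟨k, hk, ha⟩ := hk
      refine mem_playAt_of_adj L hk ha ?_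
      obtain ⟨i, hi, hi', e⟩ := exists_eq_of_injOn_Icc hm hinj (ω₁ w)
      rcases hi.eq_or_lt with rfl | hi
      · exact Or.inl (e.symm.trans h3.symm)
      · refine Or.inr ?_
        rw [hL, List.mem_map]
        refine ⟨i - (r + 1), List.mem_range.2 (by omega), ?_⟩
        rw [← e]
        congr 1
        omega
  · exact (playAt_layers_of_le hp x m hv h3 (h6 hp hz) hx
      fun i hi hi' => hinj i (i + 1) hi (by omega) (by omega)).2

end Clean

/-! ### Move sequences and noncrossing labellings -/

section Labelling

/-- No two blocks of the labelling `f` of `{0, …, t - 1}` cross. -/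
def NonCrossing (t : ℕ) (f : ℕ → ℕ) : Prop :=
  ∀ a b c d, a < b → b < c → c < d → d < t → f a = f c → f b = f d → f a = f b

variable {V C : Type*} {G : SimpleGraph V} {ω : V → C} {t : ℕ} {π : V → ℕ}

/-- Two layers that a component avoids do not separate the layers that it meets. -/
theorem Layered.between_iff (hπ : Layered G t π) {v w w' : V} {b d : ℕ} (hd : d < t)
    (hw : w ∈ monoComponent G ω v) (hw' : w' ∈ monoComponent G ω v)
    (hb : ∀ k ∈ monoComponent G ω v, π k ≠ b) (hd' : ∀ k ∈ monoComponent G ω v, π k ≠ d) :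
    (b < π w ∧ π w < d) ↔ (b < π w' ∧ π w' < d) := by
  -- An edge moves one step around the cycle, so passing between the inside and the outside of `(b,
  -- d)` means landing on `b` or `d`. Both ends of the closing edge lie outside, as `d < t`.
  have key : ∀ w ∈ monoComponent G ω v, (b < π w ∧ π w < d) ↔ (b < π v ∧ π v < d) := by
    intro w hw
    refine monoComponent_induction
      (P := fun w => (b < π w ∧ π w < d) ↔ (b < π v ∧ π v < d)) Iff.rfl ?_ hw
    intro x y hx hy hxy _ h
    rw [← h]
    have h1 := hb x hx
    have h2 := hb y hy
    have h3 := hd' x hx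
    have h4 := hd' y hy
    have h5 := hπ.cyc x y hxy
    omega
  rw [key w hw, key w' hw']

/-- A colouring that becomes monochromatic in `k` moves has a noncrossing labelling of the layers
with at most `k + 1` labels, where layers with the same label have a colour in common. -/
theorem Layered.exists_labelling (hπ : Layered G t π) (S : List (V × C)) (d : C) (ω : V → C)
    (hS : ∀ w, playMoves G ω S w = d) :
    ∃ (f : ℕ → ℕ) (col : ℕ → C), NonCrossing t f ∧
      (∀ i < t, ∃ v, π v = i ∧ ω v = col (f i)) ∧
      ((Finset.range t).image f).card ≤ S.length + 1 := by
  classical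
  induction S generalizing ω with
  | nil =>
    refine ⟨fun _ => 0, fun _ => d, fun _ _ _ _ _ _ _ _ _ _ => rfl, fun i hi => ?_, ?_⟩
    · obtain ⟨v, hv⟩ := hπ.surj i hi
      exact ⟨v, hv, hS v⟩
    · refine (Finset.card_le_card (t := {0}) ?_).trans (by simp)
      intro a ha
      obtain ⟨_, -, rfl⟩ := Finset.mem_image.1 ha
      simp
  | cons m S ih =>
    obtain ⟨v, e⟩ := m
    obtain ⟨f, col, hnc, hcol, hcard⟩ := ih (playMove G ω (v, e)) hS
    obtain ⟨M, hM⟩ : ∃ M, ∀ i < t, f i ≠ M := by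
      obtain ⟨M, hM⟩ := Infinite.exists_notMem_finset ((Finset.range t).image f)
      exact ⟨M, fun i hi h => hM (Finset.mem_image.2 ⟨i, Finset.mem_range.2 hi, h⟩)⟩
    let J : ℕ → Prop := fun i => ∃ k ∈ monoComponent G ω v, π k = i
    have hJt : ∀ i, J i → i < t := by
      rintro i ⟨k, -, rfl⟩
      exact hπ.lt k
    -- Undo the first move: the layers met by the flooded component get a fresh label with the old
    -- colour of `v`. In any other layer the witness was not recoloured, so its label remains valid.
    refine ⟨fun i => if J i then M else f i, fun a => if a = M then ω v else col a, ?_, ?_, ?_⟩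
    · intro a b c d hab hbc hcd hd hac hbd
      by_cases ha : J a
      · have hc : J c := by
          by_contra hc
          simp only [if_pos ha, if_neg hc] at hac
          exact hM c (by omega) hac.symm
        by_cases hb : J b
        · simp only [if_pos ha, if_pos hb]
        · have hd' : ¬ J d := by
            intro hd'
            simp only [if_pos hd', if_neg hb] at hbd
            exact hM b (by omega) hbd
          exfalso
          obtain ⟨k, hk, rfl⟩ := ha
          obtain ⟨k', hk', rfl⟩ := hc
          have := hπ.between_iff (b := b) (d := d) hd hk hk' (fun x hx h => hb ⟨x, hx, h⟩)
            (fun x hx h => hd' ⟨x, hx, h⟩)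
          omega
      · have hc : ¬ J c := by
          intro hc
          simp only [if_pos hc, if_neg ha] at hac
          exact hM a (by omega) hac
        by_cases hb : J b
        · have hd' : J d := by
            by_contra hd'
            simp only [if_pos hb, if_neg hd'] at hbd
            exact hM d (by omega) hbd.symm
          exfalso
          obtain ⟨k, hk, rfl⟩ := hb
          obtain ⟨k', hk', rfl⟩ := hd'
          have := hπ.between_iff (b := a) (d := c) (by omega) hk hk' (fun x hx h => ha ⟨x, hx, h⟩)
            (fun x hx h => hc ⟨x, hx, h⟩)
          omega
        · have hd' : ¬ J d := by
            intro hd'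
            simp only [if_pos hd', if_neg hb] at hbd
            exact hM b (by omega) hbd
          simp only [if_neg ha, if_neg hb, if_neg hc, if_neg hd'] at hac hbd ⊢
          exact hnc a b c d hab hbc hcd hd hac hbd
    · intro i hi
      by_cases h : J i
      · simp only [if_pos h, if_true]
        obtain ⟨k, hk, rfl⟩ := h
        exact ⟨k, rfl, color_of_mem hk⟩
      · simp only [if_neg h, if_neg (hM i hi)]
        obtain ⟨k, hk, hk'⟩ := hcol i hi
        refine ⟨k, hk, ?_⟩
        rw [← hk', playMove_of_notMem]
        exact fun h' => h ⟨k, h', hk⟩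
    · have : (Finset.range t).image (fun i => if J i then M else f i) ⊆
          insert M ((Finset.range t).image f) := by
        intro a ha
        obtain ⟨i, hi, rfl⟩ := Finset.mem_image.1 ha
        by_cases h : J i
        · simp [h]
        · simp only [if_neg h]
          exact Finset.mem_insert_of_mem (Finset.mem_image_of_mem f hi)
      refine (Finset.card_le_card this).trans ((Finset.card_insert_le _ _).trans ?_)
      simp only [List.length_cons]
      omega

/-- A noncrossing labelling with at least two labels can be improved by one move. -/
theorem Layered.exists_move (hπ : Layered G t π) {f : ℕ → ℕ} {col : ℕ → C}
    (hnc : NonCrossing t f) (hcol : ∀ i < t, ∃ v, π v = i ∧ ω v = col (f i))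
    (hcard : 2 ≤ ((Finset.range t).image f).card) :
    ∃ (m : V × C) (f' : ℕ → ℕ), NonCrossing t f' ∧
      (∀ i < t, ∃ v, π v = i ∧ playMove G ω m v = col (f' i)) ∧
      ((Finset.range t).image f').card < ((Finset.range t).image f).card := by
  classical
  -- the blocks and their extreme elements
  have hblock : ∀ a ∈ (Finset.range t).image f, ∃ lo hi, lo ≤ hi ∧ hi < t ∧ f lo = a ∧ f hi = a ∧
      ∀ i < t, f i = a → lo ≤ i ∧ i ≤ hi := by
    intro a ha
    have hne : ((Finset.range t).filter fun i => f i = a).Nonempty := by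
      obtain ⟨i, hi, rfl⟩ := Finset.mem_image.1 ha
      exact ⟨i, Finset.mem_filter.2 ⟨hi, rfl⟩⟩
    have h1 := Finset.mem_filter.1 (Finset.min'_mem _ hne)
    have h2 := Finset.mem_filter.1 (Finset.max'_mem _ hne)
    exact ⟨_, _, Finset.min'_le_max' _ hne, Finset.mem_range.1 h2.1, h1.2, h2.2, fun i hi h =>
      ⟨Finset.min'_le _ _ (Finset.mem_filter.2 ⟨Finset.mem_range.2 hi, h⟩),
        Finset.le_max' _ _ (Finset.mem_filter.2 ⟨Finset.mem_range.2 hi, h⟩)⟩⟩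
  choose! lo hi hlohi hhit hflo hfhi hmem using hblock
  obtain ⟨a, ha, hmin⟩ := Finset.exists_min_image ((Finset.range t).image f)
    (fun a => hi a - lo a) (Finset.card_pos.1 (by omega))
  have himg : ∀ i < t, f i ∈ (Finset.range t).image f := fun i h =>
    Finset.mem_image_of_mem f (Finset.mem_range.2 h)
  -- a block of least diameter is an interval
  have hint : ∀ i, lo a ≤ i → i ≤ hi a → f i = a := by
    intro i h1 h2
    by_contra hne
    have hit : i < t := h2.trans_lt (hhit a ha)
    have h1' : lo a < i := lt_of_le_of_ne h1 (by rintro rfl; exact hne (hflo a ha))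
    have h2' : i < hi a := lt_of_le_of_ne h2 (by rintro rfl; exact hne (hfhi a ha))
    have key : ∀ j < t, f j = f i → lo a < j ∧ j < hi a := by
      intro j hj e
      have e1 : j ≠ lo a := by rintro rfl; exact hne (e.symm.trans (hflo a ha))
      have e2 : j ≠ hi a := by rintro rfl; exact hne (e.symm.trans (hfhi a ha))
      by_contra hcon
      rcases Nat.lt_or_ge j (lo a) with h | h
      · have := hnc j (lo a) i (hi a) h h1' h2' (hhit a ha) e ((hflo a ha).trans (hfhi a ha).symm)
        exact hne (e.symm.trans (this.trans (hflo a ha)))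
      · have := hnc (lo a) i (hi a) j h1' h2' (by omega) hj ((hflo a ha).trans (hfhi a ha).symm)
          e.symm
        exact hne (this.symm.trans (hflo a ha))
    have hi' := himg i hit
    have k1 := key _ ((hlohi _ hi').trans_lt (hhit _ hi')) (hflo _ hi')
    have k2 := key _ (hhit _ hi') (hfhi _ hi')
    have := hmin _ hi'
    have := hlohi _ hi'
    omega
  have hat := hhit a ha
  have hle := hlohi a ha
  -- a neighbour of the block
  obtain ⟨n, hnt, hna, hn⟩ : ∃ n < t, f n ≠ a ∧ (n + 1 = lo a ∨ n = hi a + 1) := by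
    by_cases h1 : hi a + 1 < t
    · exact ⟨hi a + 1, h1, fun h => by have := (hmem a ha _ h1 h).2; omega, Or.inr rfl⟩
    · by_cases h2 : lo a = 0
      · exfalso
        have : (Finset.range t).image f ⊆ {a} := by
          intro b hb
          obtain ⟨i, hi', rfl⟩ := Finset.mem_image.1 hb
          have := Finset.mem_range.1 hi'
          exact Finset.mem_singleton.2 (hint i (by omega) (by omega))
        have := Finset.card_le_card this
        simp at this
        omega
      · exact ⟨lo a - 1, by omega, fun h => by have := (hmem a ha _ (by omega) h).1; omega,
          Or.inl (by omega)⟩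
  obtain ⟨g, hg⟩ : ∃ g : ℕ → V, ∀ i < t, π (g i) = i ∧ ω (g i) = col (f i) := by
    obtain ⟨v0, -⟩ := hcol n hnt
    refine ⟨fun i => if h : i < t then (hcol i h).choose else v0, fun i h => ?_⟩
    simp only [h, dif_pos]
    exact (hcol i h).choose_spec
  set v := g (lo a) with hv
  let J : ℕ → Prop := fun i => ∃ k ∈ monoComponent G ω v, π k = i
  have hJ : ∀ i, lo a ≤ i → i ≤ hi a → J i := fun i h1 h2 =>
    ⟨g i, hπ.mem_monoComponent g (fun j _ h => (hg j (by omega)).1)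
      (fun j h h' => by rw [(hg j (by omega)).2, (hg _ (by omega)).2, hint j h h', hflo a ha]) h1 h2,
      (hg i (by omega)).1⟩
  -- the neighbour and the component lie on the same side of two layers
  have hside : ∀ b d j, d < t → ¬ J b → ¬ J d → f b ≠ f n → f d ≠ f n → J j →
      ((b < j ∧ j < d) ↔ (b < n ∧ n < d)) := by
    rintro b d j hd hb hd' hbn hdn ⟨k, hk, rfl⟩
    obtain ⟨k₁, hk₁, e₁⟩ := hJ (lo a) le_rfl hle
    obtain ⟨k₂, hk₂, e₂⟩ := hJ (hi a) hle le_rfl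
    have s₁ := hπ.between_iff (b := b) (d := d) hd hk hk₁ (fun x hx h => hb ⟨x, hx, h⟩)
      (fun x hx h => hd' ⟨x, hx, h⟩)
    have s₂ := hπ.between_iff (b := b) (d := d) hd hk hk₂ (fun x hx h => hb ⟨x, hx, h⟩)
      (fun x hx h => hd' ⟨x, hx, h⟩)
    have n1 : b ≠ n := by rintro rfl; exact hbn rfl
    have n2 : d ≠ n := by rintro rfl; exact hdn rfl
    have n3 : b ≠ lo a := fun h => hb (h ▸ hJ _ le_rfl hle)
    have n4 : d ≠ lo a := fun h => hd' (h ▸ hJ _ le_rfl hle)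
    have n5 : b ≠ hi a := fun h => hb (h ▸ hJ _ hle le_rfl)
    have n6 : d ≠ hi a := fun h => hd' (h ▸ hJ _ hle le_rfl)
    rw [e₁] at s₁
    rw [e₂] at s₂
    omega
  -- The flooded component may reach beyond block `a`; every layer it meets is moved to the label of
  -- the neighbour `n`. Noncrossing survives because `hside` puts `n` and the component on the same
  -- side of any two layers avoided by both the component and the block of `n`.
  set f' : ℕ → ℕ := fun i => if J i then f n else f i with hf'
  have hf'J : ∀ i, f' i ≠ f n → ¬ J i ∧ f i = f' i ∧ f i ≠ f n := by
    intro i h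
    have : ¬ J i := fun hJ => h (by simp only [hf', if_pos hJ])
    simp only [hf', if_neg this] at h
    exact ⟨this, by simp only [hf', if_neg this], h⟩
  have hf'n : ∀ i, f' i = f n → J i ∨ f i = f n := by
    intro i h
    by_cases hi : J i
    · exact Or.inl hi
    · simp only [hf', if_neg hi] at h
      exact Or.inr h
  refine ⟨(v, col (f n)), f', ?_, ?_, ?_⟩
  · intro p q r s hpq hqr hrs hs hpr hqs
    by_contra hne
    by_cases hp : f' p = f n
    · obtain ⟨jq, eq, nq⟩ := hf'J q fun h => hne (hp.trans h.symm)
      obtain ⟨js, es, ns⟩ := hf'J s fun h => hne (hp.trans (hqs.trans h).symm)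
      have hqs' : f q = f s := by rw [eq, es, hqs]
      have hsd := hside q s
      have hnq : n ≠ q := by rintro rfl; exact nq rfl
      have hns : n ≠ s := by rintro rfl; exact ns rfl
      rcases hf'n p hp with h1 | h1 <;> rcases hf'n r (hpr.symm.trans hp) with h2 | h2
      · have := hside q s p hs jq js nq ns h1
        have := hside q s r hs jq js nq ns h2
        omega
      · have := hside q s p hs jq js nq ns h1
        rcases Nat.lt_or_ge n q with h | h
        · exact nq (hnc n q r s h hqr hrs hs h2.symm hqs').symm
        · exact nq ((hnc q r s n hqr hrs (by omega) hnt hqs' h2).trans h2)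
      · have := hside q s r hs jq js nq ns h2
        exact nq ((hnc p q n s hpq (by omega) (by omega) hs h1 hqs').symm.trans h1)
      · exact nq ((hnc p q r s hpq hqr hrs hs (h1.trans h2.symm) hqs').symm.trans h1)
    · obtain ⟨jp, ep, np⟩ := hf'J p hp
      obtain ⟨jr, er, nr⟩ := hf'J r fun h => hp (hpr.trans h)
      have hpr' : f p = f r := by rw [ep, er, hpr]
      have hnp : n ≠ p := by rintro rfl; exact np rfl
      have hnr : n ≠ r := by rintro rfl; exact nr rfl
      by_cases hq : f' q = f n
      · rcases hf'n q hq with h1 | h1 <;> rcases hf'n s (hqs.symm.trans hq) with h2 | h2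
        · have := hside p r q (by omega) jp jr np nr h1
          have := hside p r s (by omega) jp jr np nr h2
          omega
        · have := hside p r q (by omega) jp jr np nr h1
          exact np ((hnc p n r s (by omega) (by omega) hrs hs hpr' h2.symm))
        · have := hside p r s (by omega) jp jr np nr h2
          rcases Nat.lt_or_ge n p with h | h
          · exact np (hnc n p q r h hpq hqr (by omega) h1.symm hpr').symm
          · exact np ((hnc p q r n hpq hqr (by omega) hnt hpr' h1).trans h1)
        · exact np ((hnc p q r s hpq hqr hrs hs hpr' (h1.trans h2.symm)).trans h1)
      · obtain ⟨-, eq, -⟩ := hf'J q hq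
        obtain ⟨-, es, -⟩ := hf'J s fun h => hq (hqs.trans h)
        refine hne ?_
        rw [← ep, ← eq]
        exact hnc p q r s hpq hqr hrs hs hpr' (by rw [eq, es, hqs])
  · intro i hi
    by_cases h : J i
    · simp only [hf', if_pos h]
      obtain ⟨k, hk, rfl⟩ := h
      exact ⟨k, rfl, playMove_of_mem hk⟩
    · simp only [hf', if_neg h]
      exact ⟨g i, (hg i hi).1, by
        rw [playMove_of_notMem fun h' => h ⟨_, h', (hg i hi).1⟩, (hg i hi).2]⟩
  · have hsub : (Finset.range t).image f' ⊆ ((Finset.range t).image f).erase a := by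
      intro b hb
      obtain ⟨i, hi', rfl⟩ := Finset.mem_image.1 hb
      have hit := Finset.mem_range.1 hi'
      by_cases h : J i
      · simp only [hf', if_pos h]
        exact Finset.mem_erase.2 ⟨hna, himg n hnt⟩
      · simp only [hf', if_neg h]
        refine Finset.mem_erase.2 ⟨fun e => h ?_, himg i hit⟩
        obtain ⟨h1, h2⟩ := hmem a ha i hit e
        exact hJ i h1 h2
    exact (Finset.card_le_card hsub).trans_lt (Finset.card_erase_lt_of_mem ha)

/-- A noncrossing labelling with `b` labels gives `b - 1` moves after which all layers have a
colour in common. -/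
theorem Layered.exists_common_colour (hπ : Layered G t π) (ht : 0 < t) {col : ℕ → C} (b : ℕ) :
    ∀ (ω : V → C) (f : ℕ → ℕ), NonCrossing t f → (∀ i < t, ∃ v, π v = i ∧ ω v = col (f i)) →
      ((Finset.range t).image f).card ≤ b + 1 →
      ∃ (S : List (V × C)) (d : C), S.length ≤ b ∧
        ∀ i < t, ∃ v, π v = i ∧ playMoves G ω S v = d := by
  induction b with
  | zero =>
    intro ω f _ hcol hcard
    refine ⟨[], col (f 0), le_rfl, fun i hi => ?_⟩
    have : f i = f 0 := Finset.card_le_one.1 hcard _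
      (Finset.mem_image_of_mem f (Finset.mem_range.2 hi)) _
      (Finset.mem_image_of_mem f (Finset.mem_range.2 ht))
    rw [← this]
    exact hcol i hi
  | succ b ih =>
    intro ω f hnc hcol hcard
    by_cases h2 : 2 ≤ ((Finset.range t).image f).card
    · obtain ⟨m, f', h1, h2, h3⟩ := hπ.exists_move hnc hcol h2
      obtain ⟨S, d, h4, h5⟩ := ih (playMove G ω m) f' h1 h2 (by omega)
      exact ⟨m :: S, d, by simpa using h4, h5⟩
    · obtain ⟨S, d, h4, h5⟩ := ih ω f hnc hcol (by omega)
      exact ⟨S, d, by omega, h5⟩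

end Labelling

/-! ### Counting merges in noncrossing partitions of intervals -/

section Arcs

/-- The interval `{p, …, q}` has a noncrossing partition into blocks on which `x` is constant that
merges at least `s` times; `f` sends each element to the least element of its block. -/
def Arcs {C : Type*} (x : ℕ → C) (p q s : ℕ) : Prop :=
  p ≤ q ∧ ∃ f : ℕ → ℕ,
    (∀ i, p ≤ i → i ≤ q → p ≤ f i ∧ f i ≤ i ∧ f (f i) = f i ∧ x (f i) = x i) ∧
    (∀ a b c d, p ≤ a → a < b → b < c → c < d → d ≤ q → f a = f c → f b = f d → f a = f b) ∧
    ((Finset.Icc p q).filter fun i => f i = i).card + s ≤ q - p + 1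

variable {C : Type*} {x y : ℕ → C} {p q r s s' : ℕ}

theorem Arcs.zero (h : p ≤ q) : Arcs x p q 0 := by
  refine ⟨h, id, fun i hi _ => ⟨hi, le_rfl, rfl, rfl⟩, fun a b c d _ h1 h2 _ _ h3 _ => ?_, ?_⟩
  · simp only [id] at h3
    omega
  · have := Finset.card_filter_le (Finset.Icc p q) fun i => id i = i
    rw [Nat.card_Icc] at this
    omega

theorem Arcs.congr (h : Arcs x p q s) (hxy : ∀ i, p ≤ i → i ≤ q → y i = x i) :
    Arcs y p q s := by
  obtain ⟨h1, f, h2, h3⟩ := h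
  refine ⟨h1, f, fun i hi hi' => ?_, h3⟩
  obtain ⟨k1, k2, k3, k4⟩ := h2 i hi hi'
  exact ⟨k1, k2, k3, by rw [hxy _ k1 (k2.trans hi'), hxy i hi hi', k4]⟩

theorem Arcs.arc (h : p < q) (hx : x p = x q) : Arcs x p q 1 := by
  refine ⟨h.le, fun i => if i = q then p else i, ?_, ?_, ?_⟩
  · intro i hi hi'
    by_cases hiq : i = q
    · subst hiq
      simp only [if_true, if_neg h.ne]
      exact ⟨le_rfl, h.le, trivial, hx⟩
    · simp only [if_neg hiq]
      exact ⟨hi, le_rfl, trivial, trivial⟩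
  · intro a b c d h1 h2 h3 h4 h5 h6 _
    simp only [show a ≠ q by omega, show c ≠ q by omega, if_false] at h6
    omega
  · have : ((Finset.Icc p q).filter fun i => (if i = q then p else i) = i) ⊆
        (Finset.Icc p q).erase q := by
      intro i hi
      rw [Finset.mem_filter] at hi
      refine Finset.mem_erase.2 ⟨?_, hi.1⟩
      rintro rfl
      have := hi.2
      simp only [if_true] at this
      omega
    have h2 := Finset.card_le_card this
    rw [Finset.card_erase_of_mem (Finset.mem_Icc.2 ⟨h.le, le_rfl⟩), Nat.card_Icc] at h2
    beta_reduce
    omega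

theorem Arcs.nest (h : Arcs x (p + 1) q s) (hx : x p = x (q + 1)) :
    Arcs x p (q + 1) (s + 1) := by
  obtain ⟨h1, f, h2, h3, h4⟩ := h
  refine ⟨by omega, fun i => if i = p ∨ i = q + 1 then p else f i, ?_, ?_, ?_⟩
  · intro i hi hi'
    by_cases hiq : i = p ∨ i = q + 1
    · simp only [if_pos hiq, true_or, if_true]
      refine ⟨le_rfl, hi, trivial, ?_⟩
      rcases hiq with rfl | rfl
      · rfl
      · exact hx
    · obtain ⟨k1, k2, k3, k4⟩ := h2 i (by omega) (by omega)
      have : ¬ (f i = p ∨ f i = q + 1) := by omega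
      simp only [if_neg hiq, if_neg this]
      exact ⟨by omega, k2, k3, k4⟩
  · intro a b c d ha hab hbc hcd hd hac hbd
    have hb : ¬ (b = p ∨ b = q + 1) := by omega
    have hc : ¬ (c = p ∨ c = q + 1) := by omega
    simp only [if_neg hb, if_neg hc] at hac hbd ⊢
    have kb := h2 b (by omega) (by omega)
    have kc := h2 c (by omega) (by omega)
    by_cases ha' : a = p ∨ a = q + 1
    · simp only [if_pos ha'] at hac
      omega
    · by_cases hd' : d = p ∨ d = q + 1
      · simp only [if_pos hd'] at hbd
        omega
      · simp only [if_neg ha', if_neg hd'] at hac hbd ⊢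
        exact h3 a b c d (by omega) hab hbc hcd (by omega) hac hbd
  · have : ((Finset.Icc p (q + 1)).filter fun i => (if i = p ∨ i = q + 1 then p else f i) = i) ⊆
        insert p ((Finset.Icc (p + 1) q).filter fun i => f i = i) := by
      intro i hi
      rw [Finset.mem_filter, Finset.mem_Icc] at hi
      rw [Finset.mem_insert, Finset.mem_filter, Finset.mem_Icc]
      by_cases hiq : i = p ∨ i = q + 1
      · have := hi.2
        simp only [if_pos hiq] at this
        exact Or.inl this.symm
      · have := hi.2
        simp only [if_neg hiq] at this
        exact Or.inr ⟨by omega, this⟩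
    have h5 := (Finset.card_le_card this).trans (Finset.card_insert_le _ _)
    beta_reduce
    omega

/-- Merges add over intervals that share an endpoint: uniting the two blocks of `q` compensates for
counting `q` twice, and creates no crossing. -/
theorem Arcs.trans (h : Arcs x p q s) (h' : Arcs x q r s') : Arcs x p r (s + s') := by
  obtain ⟨hpq, f, hf, hnf, hcf⟩ := h
  obtain ⟨hqr, g, hg, hng, hcg⟩ := h'
  have hfq := hf q hpq le_rfl
  have hgq : g q = q := by
    have := hg q le_rfl hqr
    omega
  set e : ℕ → ℕ := fun i => if i ≤ q then f i else if g i = q then f q else g i with he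
  have e1 : ∀ i ≤ q, e i = f i := fun i hi => by simp only [he, if_pos hi]
  have e2 : ∀ i, q < i → g i = q → e i = f q := fun i hi h => by
    simp only [he, if_neg (not_le.2 hi), if_pos h]
  have e3 : ∀ i, q < i → g i ≠ q → e i = g i := fun i hi h => by
    simp only [he, if_neg (not_le.2 hi), if_neg h]
  have emix : ∀ i j, p ≤ i → i ≤ q → q < j → j ≤ r → e i = e j → g j = q ∧ f i = f q := by
    intro i j hi hi' hj hj' h
    have h1 := hf i hi hi'
    have h2 := hg j hj.le hj'
    rw [e1 i hi'] at h
    by_cases h3 : g j = q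
    · exact ⟨h3, h.trans (e2 j hj h3)⟩
    · rw [e3 j hj h3] at h
      omega
  have eright : ∀ i j, q < i → i ≤ r → q < j → j ≤ r → (e i = e j ↔ g i = g j) := by
    intro i j hi hi' hj hj'
    have h1 := hg i hi.le hi'
    have h2 := hg j hj.le hj'
    by_cases h3 : g i = q <;> by_cases h4 : g j = q
    · rw [e2 i hi h3, e2 j hj h4, h3, h4]
      simp
    · rw [e2 i hi h3, e3 j hj h4]
      omega
    · rw [e3 i hi h3, e2 j hj h4]
      omega
    · rw [e3 i hi h3, e3 j hj h4]
  refine ⟨hpq.trans hqr, e, ?_, ?_, ?_⟩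
  · intro i hi hi'
    by_cases h1 : i ≤ q
    · have := hf i hi h1
      rw [e1 i h1, e1 (f i) (by omega)]
      exact this
    · have hgi := hg i (by omega) hi'
      by_cases h2 : g i = q
      · rw [e2 i (by omega) h2, e1 (f q) (by omega)]
        refine ⟨hfq.1, by omega, hfq.2.2.1, ?_⟩
        rw [hfq.2.2.2, ← hgi.2.2.2, h2]
      · rw [e3 i (by omega) h2, e3 (g i) (by omega) (by rwa [hgi.2.2.1])]
        exact ⟨by omega, hgi.2.1, hgi.2.2.1, hgi.2.2.2⟩
  · intro a b c d ha hab hbc hcd hd hac hbd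
    by_cases hdq : d ≤ q
    · rw [e1 a (by omega), e1 c (by omega)] at hac
      rw [e1 b (by omega), e1 d (by omega)] at hbd
      rw [e1 a (by omega), e1 b (by omega)]
      exact hnf a b c d ha hab hbc hcd hdq hac hbd
    · by_cases hbq : b ≤ q
      · have hb := (emix b d (by omega) hbq (by omega) hd hbd).2
        rw [e1 a (by omega), e1 b hbq]
        by_cases hcq : c ≤ q
        · rw [e1 a (by omega), e1 c hcq] at hac
          rcases hcq.eq_or_lt with rfl | hcq
          · exact hac.trans hb.symm
          · exact hnf a b c q ha hab hbc hcq le_rfl hac hb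
        · rw [(emix a c ha (by omega) (by omega) (by omega) hac).2, hb]
      · have hbd' := (eright b d (by omega) (by omega) (by omega) hd).1 hbd
        by_cases haq : a ≤ q
        · obtain ⟨h1, h2⟩ := emix a c ha haq (by omega) (by omega) hac
          have := hng q b c d le_rfl (by omega) hbc hcd hd (hgq.trans h1.symm) hbd'
          rw [e1 a haq, e2 b (by omega) (this.symm.trans hgq), h2]
        · have hac' := (eright a c (by omega) (by omega) (by omega) (by omega)).1 hac
          exact (eright a b (by omega) (by omega) (by omega) (by omega)).2
            (hng a b c d (by omega) hab hbc hcd hd hac' hbd')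
  · have hsub : ((Finset.Icc p r).filter fun i => e i = i) ⊆
        ((Finset.Icc p q).filter fun i => f i = i) ∪
          ((Finset.Icc q r).filter fun i => g i = i).erase q := by
      intro i hi
      rw [Finset.mem_filter, Finset.mem_Icc] at hi
      rw [Finset.mem_union, Finset.mem_erase, Finset.mem_filter, Finset.mem_filter, Finset.mem_Icc,
        Finset.mem_Icc]
      obtain ⟨hi, h⟩ := hi
      by_cases h1 : i ≤ q
      · rw [e1 i h1] at h
        exact Or.inl ⟨⟨hi.1, h1⟩, h⟩
      · by_cases h2 : g i = q
        · rw [e2 i (by omega) h2] at h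
          omega
        · rw [e3 i (by omega) h2] at h
          exact Or.inr ⟨by omega, by omega, h⟩
    have h1 := (Finset.card_le_card hsub).trans (Finset.card_union_le _ _)
    have hq : q ∈ (Finset.Icc q r).filter fun i => g i = i :=
      Finset.mem_filter.2 ⟨Finset.mem_Icc.2 ⟨le_rfl, hqr⟩, hgq⟩
    have h2 := Finset.card_pos.2 ⟨q, hq⟩
    rw [Finset.card_erase_of_mem hq] at h1
    omega

theorem Arcs.mono {p' q' : ℕ} (h : Arcs x p q s) (hp : p' ≤ p) (hq : q ≤ q') :
    Arcs x p' q' s := by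
  simpa using ((Arcs.zero hp).trans h).trans (Arcs.zero hq)

end Arcs

/-! ### Extra merges, or a rigid rainbow window -/

section Gain

variable {c : ℕ} {x : ℕ → Fin c} {p : ℕ}

/-- Among `c + 1` consecutive layers two have the same chosen colour, so each step of length `c`
contributes one merge. -/
theorem Arcs.of_colours (x : ℕ → Fin c) (p k : ℕ) : Arcs x p (p + k * c) k := by
  induction k with
  | zero => simpa using Arcs.zero (x := x) (le_refl p)
  | succ k ih =>
    refine ih.trans (s' := 1) ?_
    obtain ⟨i, j, hij, e⟩ := Fintype.exists_ne_map_eq_of_card_lt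
      (fun i : Fin (c + 1) => x (p + k * c + i)) (by simp)
    have hi := i.2
    have hj := j.2
    have e1 : (k + 1) * c = k * c + c := by ring
    rcases Nat.lt_or_gt_of_ne (fun h => hij (Fin.ext h)) with h | h
    · exact (Arcs.arc (by omega) e).mono (by omega) (by omega)
    · exact (Arcs.arc (by omega) e.symm).mono (by omega) (by omega)

/-- A repetition already among `c` layers saves one layer compared with pigeonhole. -/
theorem Arcs.of_repeat {k i j : ℕ} (hi : p + k * c ≤ i) (hij : i < j) (hj : j < p + (k + 1) * c)
    (e : x i = x j) : Arcs x p (p + (k + 1) * c - 1) (k + 1) :=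
  (Arcs.of_colours x p k).trans ((Arcs.arc hij e).mono hi (by omega))

/-- At the first failure `j` of periodicity, the colour of `j + c` recurs at some `b` and that of
`j` at some `d` with `j < b < j + c < d`. The nested arcs `{b, j + c}` and `{j, d}` give two merges
within two blocks of `c` layers. -/
theorem Arcs.of_not_periodic {k j : ℕ}
    (h0 : ∀ i j, p + k * c ≤ i → i < j → j < p + (k + 1) * c → x i ≠ x j)
    (h1 : ∀ i j, p + (k + 1) * c ≤ i → i < j → j < p + (k + 2) * c → x i ≠ x j)
    (hj : p + k * c ≤ j) (hj' : j < p + (k + 1) * c) (e : x (j + c) ≠ x j) :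
    Arcs x p (p + (k + 2) * c - 1) (k + 2) := by
  classical
  have hc : 0 < c := (x 0).pos
  have e1 : (k + 1) * c = k * c + c := by ring
  have e2 : (k + 2) * c = k * c + c + c := by ring
  have hex : ∃ j, p + k * c ≤ j ∧ j < p + (k + 1) * c ∧ x (j + c) ≠ x j := ⟨j, hj, hj', e⟩
  obtain ⟨j, ⟨hj, hj', e⟩, hmin⟩ : ∃ j, (p + k * c ≤ j ∧ j < p + (k + 1) * c ∧ x (j + c) ≠ x j) ∧
      ∀ i < j, ¬ (p + k * c ≤ i ∧ i < p + (k + 1) * c ∧ x (i + c) ≠ x i) :=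
    ⟨Nat.find hex, Nat.find_spec hex, fun i hi => Nat.find_min hex hi⟩
  have hmin' : ∀ i, p + k * c ≤ i → i < j → x (i + c) = x i := fun i h h' => by
    by_contra hne
    exact hmin i h' ⟨h, by omega, hne⟩
  obtain ⟨b, hb, hb', eb⟩ := exists_eq_of_injOn_Icc (m := c - 1) (by omega)
    (fun i j h h' h'' => h0 i j h h' (by omega)) (x (j + c))
  obtain ⟨d, hd, hd', ed⟩ := exists_eq_of_injOn_Icc (m := c - 1) (by omega)
    (fun i j h h' h'' => h1 i j h h' (by omega)) (x j)
  -- By minimality of `j`, an earlier `b` would repeat its colour at `b + c`, in the same rainbow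
  -- block as `j + c`.
  have hjb : j < b := by
    by_contra hcon
    rcases (not_lt.1 hcon).eq_or_lt with rfl | h
    · exact e eb.symm
    · exact h1 (b + c) (j + c) (by omega) (by omega) (by omega) ((hmin' b hb h).trans eb)
  have hjd : j + c < d := by
    by_contra hcon
    rcases (not_lt.1 hcon).eq_or_lt with rfl | h
    · exact e ed
    · have := hmin' (d - c) (by omega) (by omega)
      rw [Nat.sub_add_cancel (by omega)] at this
      exact h0 (d - c) j (by omega) (by omega) (by omega) (this.symm.trans ed)
  refine (Arcs.of_colours x p k).trans (s' := 2) ?_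
  have h2 : Arcs x (j + 1) (d - 1) 1 := (Arcs.arc (by omega) eb).mono (by omega) (by omega)
  refine (h2.nest ?_).mono hj (by omega)
  rw [Nat.sub_add_cancel (by omega), ed]

/-- In three consecutive blocks of `c` layers either there are more merges than expected, or the
layers (but for the first) are single-coloured and any `c` consecutive layers have distinct
colours. -/
theorem exists_arcs_or_rainbow {t : ℕ} (K : ℕ → Fin c → Prop)
    (hK : ∀ i < t, K i (x i)) :
    (∃ (x' : ℕ → Fin c) (q s : ℕ), (∀ i < t, K i (x' i)) ∧ (∀ i ≤ p, x' i = x i) ∧ q < p + 3 * c ∧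
      Arcs x' p q s ∧ q + 1 ≤ p + c * s) ∨
    ((∀ i j, p ≤ i → i < j → j < i + c → j < p + 3 * c → x i ≠ x j) ∧
      ∀ i a, p < i → i < p + 3 * c → K i a → a = x i) := by
  classical
  have hc : 0 < c := (x 0).pos
  by_contra! hcon
  obtain ⟨hcon, hcon'⟩ := hcon
  have hmul : ∀ k, c * k = k * c := fun k => mul_comm c k
  have hinj : ∀ k < 3, ∀ i j, p + k * c ≤ i → i < j → j < p + (k + 1) * c → x i ≠ x j := by
    intro k hk i j hi hij hj e
    have h1 : (k + 1) * c ≤ 3 * c := Nat.mul_le_mul_right c (by omega)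
    have := hcon x _ _ hK (fun _ _ => rfl) (by omega) (Arcs.of_repeat hi hij hj e)
    rw [hmul] at this
    have : 0 < (k + 1) * c := by positivity
    omega
  have hper : ∀ k < 2, ∀ j, p + k * c ≤ j → j < p + (k + 1) * c → x (j + c) = x j := by
    intro k hk j hj hj'
    by_contra e
    have h1 : (k + 2) * c ≤ 3 * c := Nat.mul_le_mul_right c (by omega)
    have := hcon x _ _ hK (fun _ _ => rfl) (by omega)
      (Arcs.of_not_periodic (hinj k (by omega)) (hinj (k + 1) (by omega)) hj hj' e)
    rw [hmul] at this
    have : 0 < (k + 2) * c := by positivity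
    omega
  obtain ⟨m, a, hm, hm', hKa, hne⟩ := hcon' <| by
    intro i j hi hij hjc hj e
    obtain ⟨k, hk, hk1, hk2⟩ : ∃ k < 3, p + k * c ≤ i ∧ i < p + (k + 1) * c := by
      by_cases h1 : i < p + c
      · exact ⟨0, by omega, by omega, by omega⟩
      · by_cases h2 : i < p + 2 * c
        · exact ⟨1, by omega, by omega, by omega⟩
        · exact ⟨2, by omega, by omega, by omega⟩
    by_cases hj1 : j < p + (k + 1) * c
    · exact hinj k hk i j hk1 hij hj1 e
    · have e1 : (k + 1) * c = k * c + c := by ring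
      have hk3 : k < 2 := by
        by_contra hk3
        obtain rfl : k = 2 := by omega
        omega
      have := hper k hk3 (j - c) (by omega) (by omega)
      rw [Nat.sub_add_cancel (by omega)] at this
      exact hinj k hk (j - c) i (by omega) (by omega) hk2 (by rw [← this, e])
  obtain ⟨k, hk, hk1, hk2⟩ : ∃ k < 3, p + k * c ≤ m ∧ m < p + (k + 1) * c := by
    by_cases h1 : m < p + c
    · exact ⟨0, by omega, by omega, by omega⟩
    · by_cases h2 : m < p + 2 * c
      · exact ⟨1, by omega, by omega, by omega⟩
      · exact ⟨2, by omega, by omega, by omega⟩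
  have e1 : (k + 1) * c = k * c + c := by ring
  obtain ⟨b, hb, hb', eb⟩ := exists_eq_of_injOn_Icc (m := c - 1) (by omega)
    (fun i j h h' h'' => hinj k hk i j h h' (by omega)) a
  have hbm : b ≠ m := by
    rintro rfl
    exact hne eb.symm
  have h1 : (k + 1) * c ≤ 3 * c := Nat.mul_le_mul_right c (by omega)
  -- A second colour `a` in layer `m` is the chosen colour of another layer `b` of the same rainbow
  -- block, so choosing `a` instead creates a repetition. Layer `p` is exempt, since the choice
  -- there is shared with the preceding interval.
  have hx' : Arcs (Function.update x m a) p (p + (k + 1) * c - 1) (k + 1) := by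
    rcases Nat.lt_or_gt_of_ne hbm with h | h
    · exact Arcs.of_repeat hb h (by omega) (by rw [Function.update_self,
        Function.update_of_ne hbm, eb])
    · exact Arcs.of_repeat hk1 h (by omega) (by rw [Function.update_self,
        Function.update_of_ne hbm, eb])
  have := hcon _ _ _ (fun i hi => ?_) (fun i hi => ?_) ?_ hx'
  · rw [hmul] at this
    have : 0 < (k + 1) * c := by positivity
    omega
  · by_cases him : i = m
    · subst him
      rwa [Function.update_self]
    · rw [Function.update_of_ne him]
      exact hK i hi
  · exact Function.update_of_ne (by omega) _ _
  · omega

/-- Windows are scanned from left to right. Choices up to the current endpoint never change later,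
so the earlier merges persist and each non-rigid window adds one to `c * s - q`. -/
theorem exists_arcs_or_rainbow_of_le {t : ℕ} (K : ℕ → Fin c → Prop) (hK : ∀ i < t, K i (x i))
    (n : ℕ) (hn : 3 * c * n + 3 * c ≤ t) :
    (∃ (x : ℕ → Fin c) (q s : ℕ), (∀ i < t, K i (x i)) ∧ q ≤ 3 * c * n ∧ Arcs x 0 q s ∧
      q + n ≤ c * s) ∨
    ∃ (x : ℕ → Fin c) (p : ℕ), p ≤ 3 * c * n ∧ (∀ i < t, K i (x i)) ∧
      (∀ i j, p ≤ i → i < j → j < i + c → j < p + 3 * c → x i ≠ x j) ∧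
      ∀ i a, p < i → i < p + 3 * c → K i a → a = x i := by
  induction n with
  | zero => exact Or.inl ⟨x, 0, 0, hK, by omega, Arcs.zero le_rfl, by omega⟩
  | succ n ih =>
    have e : 3 * c * (n + 1) = 3 * c * n + 3 * c := by ring
    rcases ih (by omega) with ⟨x, q, s, h1, h2, h3, h4⟩ | ⟨x, p, h1, h2⟩
    · rcases exists_arcs_or_rainbow (p := q) K h1 with
        ⟨x', q', s', k1, k2, k3, k4, k5⟩ | ⟨h5, h6⟩
      · refine Or.inl ⟨x', q', s + s', k1, by omega,
          (h3.congr fun i _ hi => k2 i hi).trans k4, ?_⟩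
        rw [mul_add]
        omega
      · exact Or.inr ⟨x, q, by omega, h1, h5, h6⟩
    · exact Or.inr ⟨x, p, by omega, h2⟩

end Gain

/-! ### Counting labels of a noncrossing labelling -/

section LowerBound

/-- A noncrossing labelling of an interval of length `n` with labels that determine the residue
modulo `c ≥ 2` has at least `n - ⌊(n - 1) / c⌋` labels. -/
theorem le_card_image_add {c : ℕ} (hc : 2 ≤ c) (f : ℕ → ℕ) (n : ℕ) : ∀ a, 1 ≤ n →
    (∀ i j, a ≤ i → i < j → j < a + n → f i = f j → ∃ k, j = i + c * k) →
    (∀ i j k l, a ≤ i → i < j → j < k → k < l → l < a + n → f i = f k → f j = f l → f i = f j) →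
    n ≤ ((Finset.Ico a (a + n)).image f).card + (n - 1) / c := by
  induction n using Nat.strong_induction_on with
  | _ n ih =>
  intro a hn hres hnc
  by_cases hex : ∃ j, a < j ∧ j < a + n ∧ f a = f j
  · obtain ⟨j, ⟨h1, h2, h3⟩, hmin⟩ : ∃ j, (a < j ∧ j < a + n ∧ f a = f j) ∧
        ∀ i < j, ¬ (a < i ∧ i < a + n ∧ f a = f i) :=
      ⟨Nat.find hex, Nat.find_spec hex, fun i hi => Nat.find_min hex hi⟩
    obtain ⟨k, rfl⟩ := hres a j le_rfl h1 h2 h3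
    have hk0 : 1 ≤ k := by
      rcases Nat.eq_zero_or_pos k with rfl | h
      · omega
      · exact h
    have hck : c ≤ c * k := Nat.le_mul_of_pos_right c hk0
    have hL := ih (c * k - 1) (by omega) (a + 1) (by omega)
      (fun i j h h' h'' => hres i j (by omega) h' (by omega))
      (fun i j k l h h1 h2 h3 h4 => hnc i j k l (by omega) h1 h2 h3 (by omega))
    have hR := ih (n - c * k) (by omega) (a + c * k) (by omega)
      (fun i j h h' h'' => hres i j (by omega) h' (by omega))
      (fun i j k l h h1 h2 h3 h4 => hnc i j k l (by omega) h1 h2 h3 (by omega))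
    -- The first return to the label of `a` separates the interval: a label on both sides would
    -- cross this arc, or recur earlier than the first return.
    have hdisj : Disjoint ((Finset.Ico (a + 1) (a + 1 + (c * k - 1))).image f)
        ((Finset.Ico (a + c * k) (a + c * k + (n - c * k))).image f) := by
      rw [Finset.disjoint_left]
      intro b hb hb'
      obtain ⟨i, hi, rfl⟩ := Finset.mem_image.1 hb
      obtain ⟨l, hl, e⟩ := Finset.mem_image.1 hb'
      rw [Finset.mem_Ico] at hi hl
      refine hmin i (by omega) ⟨by omega, by omega, ?_⟩
      rcases hl.1.eq_or_lt with rfl | hlt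
      · rw [h3, e]
      · exact hnc a i (a + c * k) l le_rfl (by omega) (by omega) hlt (by omega) h3 e.symm
    have hsub : ((Finset.Ico (a + 1) (a + 1 + (c * k - 1))).image f) ∪
        ((Finset.Ico (a + c * k) (a + c * k + (n - c * k))).image f) ⊆
          (Finset.Ico a (a + n)).image f := by
      rw [← Finset.image_union]
      refine Finset.image_subset_image fun i hi => ?_
      simp only [Finset.mem_union, Finset.mem_Ico] at hi ⊢
      omega
    have hcard := Finset.card_le_card hsub
    rw [Finset.card_union_of_disjoint hdisj] at hcard
    -- The enclosed `c * k - 1` layers save at most `k - 1` labels and the arc saves one more, which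
    -- together match the `k` in `d2`.
    have d1 : (c * k - 1 - 1) / c < k := Nat.div_lt_of_lt_mul (by omega)
    have d2 : (n - 1) / c = (n - c * k - 1) / c + k := by
      rw [← Nat.add_mul_div_left _ _ (by omega : 0 < c)]
      congr 1
      omega
    omega
  · rcases hn.eq_or_lt with rfl | hn
    · have : 1 ≤ ((Finset.Ico a (a + 1)).image f).card := by simp
      exact this.trans (Nat.le_add_right _ _)
    · have h1 := ih (n - 1) (by omega) (a + 1) (by omega)
        (fun i j h h' h'' => hres i j (by omega) h' (by omega))
        (fun i j k l h h1 h2 h3 h4 => hnc i j k l (by omega) h1 h2 h3 (by omega))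
      have hsub : insert (f a) ((Finset.Ico (a + 1) (a + 1 + (n - 1))).image f) ⊆
          (Finset.Ico a (a + n)).image f := by
        rw [← Finset.image_insert]
        refine Finset.image_subset_image fun i hi => ?_
        simp only [Finset.mem_insert, Finset.mem_Ico] at hi ⊢
        omega
      have hcard := Finset.card_le_card hsub
      rw [Finset.card_insert_of_notMem] at hcard
      · have : (n - 1 - 1) / c ≤ (n - 1) / c := Nat.div_le_div_right (by omega)
        omega
      · intro hmem
        obtain ⟨j, hj, e⟩ := Finset.mem_image.1 hmem
        rw [Finset.mem_Ico] at hj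
        exact hex ⟨j, by omega, by omega, e.symm⟩

end LowerBound

/-! ### Assembling the upper and lower bounds -/

section Upper

variable {V : Type*} {G : SimpleGraph V} {t c : ℕ} {π : V → ℕ}

theorem Layered.reflect (hπ : Layered G t π) : Layered G t fun v => t - 1 - π v where
  lt v := by have := hπ.lt v; omega
  surj i hi := by
    obtain ⟨v, hv⟩ := hπ.surj (t - 1 - i) (by omega)
    exact ⟨v, by omega⟩
  adj u v h := (hπ.adj v u (by have := hπ.lt u; have := hπ.lt v; omega)).symm
  cyc u v h := by
    have := hπ.cyc u v h
    have := hπ.lt u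
    have := hπ.lt v
    omega

theorem Layered.rotate (hπ : Layered G t π)
    (hcl : ∀ u v, π u + 1 = t → π v = 0 → G.Adj u v) {k : ℕ} (hk : k ≤ t) :
    Layered G t fun v => if π v + k < t then π v + k else π v + k - t where
  lt v := by have := hπ.lt v; split_ifs <;> omega
  surj i hi := by
    rcases Nat.lt_or_ge i k with h | h
    · obtain ⟨v, hv⟩ := hπ.surj (i + t - k) (by omega)
      exact ⟨v, by split_ifs <;> omega⟩
    · obtain ⟨v, hv⟩ := hπ.surj (i - k) (by omega)
      exact ⟨v, by split_ifs <;> omega⟩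
  adj u v h := by
    have h1 := hπ.lt u
    have h2 := hπ.lt v
    by_cases h3 : π v = π u + 1
    · exact hπ.adj u v h3
    · refine hcl u v ?_ ?_ <;> split_ifs at h <;> omega
  cyc u v h := by
    have := hπ.cyc u v h
    have h1 := hπ.lt u
    have h2 := hπ.lt v
    split_ifs <;> omega

/-- The `t - s` blocks cost `t - s - 1` moves, giving a component that meets all layers. It is
adjacent to every vertex since `t ≥ 2`, and playing the other `c - 1` colours absorbs the rest. -/
theorem Layered.exists_moves_of_arcs (hπ : Layered G t π) (ht : 2 ≤ t) {ω : V → Fin c}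
    {x : ℕ → Fin c} {s : ℕ} (hx : ∀ i < t, ∃ v, π v = i ∧ ω v = x i)
    (hs : Arcs x 0 (t - 1) s) :
    ∃ (S : List (V × Fin c)) (d : Fin c), (∀ w, playMoves G ω S w = d) ∧
      S.length + s + 2 ≤ t + c := by
  obtain ⟨-, f, hf, hnc, hcard⟩ := hs
  have himg : (Finset.range t).image f ⊆ (Finset.Icc 0 (t - 1)).filter fun i => f i = i := by
    intro a ha
    obtain ⟨i, hi, rfl⟩ := Finset.mem_image.1 ha
    have hi' := Finset.mem_range.1 hi
    have := hf i (by omega) (by omega)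
    exact Finset.mem_filter.2 ⟨Finset.mem_Icc.2 ⟨by omega, by omega⟩, this.2.2.1⟩
  have hpos : 1 ≤ ((Finset.range t).image f).card :=
    Finset.card_pos.2 ⟨f 0, Finset.mem_image_of_mem f (Finset.mem_range.2 (by omega))⟩
  have hle := Finset.card_le_card himg
  obtain ⟨S, d, hS, hd⟩ := hπ.exists_common_colour (col := x) (by omega)
    (((Finset.range t).image f).card - 1) ω f
    (fun a b c d h1 h2 h3 h4 => hnc a b c d (by omega) h1 h2 h3 (by omega))
    (fun i hi => by rw [(hf i (by omega) (by omega)).2.2.2]; exact hx i hi) (by omega)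
  have : Nonempty V := (hd 0 (by omega)).nonempty
  choose! g hg hgd using hd
  set ω₁ := playMoves G ω S
  have hmem : ∀ i < t, g i ∈ monoComponent G ω₁ (g 0) := fun i hi =>
    hπ.mem_monoComponent (l := 0) (r := i) g (fun j _ h => hg j (by omega))
      (fun j _ h => by rw [hgd j (by omega), hgd 0 (by omega)]) (by omega) le_rfl
  set L := (Finset.univ.erase d).toList with hL
  have hc : 0 < c := d.pos
  have hplay : playMoves G ω (S ++ L.map fun d => (g 0, d)) = playAt G ω₁ (g 0) L := by
    rw [playMoves_append]
    rfl
  refine ⟨S ++ L.map fun d => (g 0, d), playAt G ω₁ (g 0) L (g 0), fun w => ?_, ?_⟩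
  · rw [hplay]
    refine color_of_mem (G := G) ?_
    have hk : ∃ k ∈ monoComponent G ω₁ (g 0), G.Adj k w := by
      have hw := hπ.lt w
      by_cases h : π w + 1 < t
      · exact ⟨_, hmem _ h, (hπ.adj _ _ (hg _ h)).symm⟩
      · exact ⟨_, hmem (π w - 1) (by omega), hπ.adj _ _ (by rw [hg _ (by omega)]; omega)⟩
    obtain ⟨k, hk, ha⟩ := hk
    refine mem_playAt_of_adj L hk ha ?_
    rw [hgd 0 (by omega)]
    by_cases h : ω₁ w = d
    · exact Or.inl h
    · exact Or.inr (by simp [hL, h])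
  · have : L.length = c - 1 := by simp [hL]
    simp only [List.length_append, List.length_map, this]
    omega

/-- If some `c` consecutive layers of a cyclic arrangement are single-coloured with distinct
colours, then `t - ⌈t / c⌉` moves suffice. -/
theorem Layered.exists_moves_of_cyclic (hπ : Layered G t π)
    (hcl : ∀ u v, π u + 1 = t → π v = 0 → G.Adj u v) (hc : 2 ≤ c) {ω : V → Fin c}
    {x : ℕ → Fin c} {p : ℕ} (hp : p + c ≤ t) (hct : c + 2 ≤ t)
    (hx : ∀ w, p ≤ π w → π w < p + c → ω w = x (π w))
    (hinj : ∀ i j, p ≤ i → i < j → j < p + c → x i ≠ x j) :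
    ∃ (S : List (V × Fin c)) (d : Fin c) (n : ℕ), (∀ w, playMoves G ω S w = d) ∧
      S.length + n ≤ t ∧ t ≤ c * n := by
  -- This rotation takes the rainbow layers to `t - c, …, t - 1`, so the sweep ends in the last
  -- layer.
  have hrot := hπ.rotate hcl (k := t - c - p) (by omega)
  obtain ⟨S, n, h1, h2, -, h3, -⟩ := hrot.exists_clean (ω := ω) (r := t - c) (m := c - 1)
    (x := fun i => x (i - (t - c) + p)) (by omega) (by omega) (by omega) (by omega)
    (fun w hw hw' => by
      have hwt := hπ.lt w
      split_ifs at hw hw' ⊢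
      · rw [hx w (by omega) (by omega)]
        congr 1
        omega
      · omega)
    (fun i j hi hij hj => hinj _ _ (by omega) (by omega) (by omega))
  refine ⟨S, _, n + 1, fun w => h3 w ?_, by omega, by rw [mul_add]; omega⟩
  have := hrot.lt w
  omega

/-- If `2 c + 1` consecutive layers of a linear arrangement are single-coloured with any `c`
consecutive ones having distinct colours, and the middle one is a multiple of `c`, then
`t - ⌈t / c⌉` moves suffice. -/
theorem Layered.exists_moves_of_linear (hπ : Layered G t π)
    (hlin : ∀ u v, G.Adj u v → π v ≤ π u + 1) (hc : 2 ≤ c) {ω : V → Fin c}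
    {x : ℕ → Fin c} {k : ℕ} (hk : 2 ≤ k) (hkt : c * k + c + 2 ≤ t)
    (hx : ∀ w, c * k ≤ π w + c → π w < c * k + c → ω w = x (π w))
    (hinj : ∀ i j, c * k ≤ i + c → i < j → j < i + c → j < c * k + c → x i ≠ x j) :
    ∃ (S : List (V × Fin c)) (d : Fin c) (n : ℕ), (∀ w, playMoves G ω S w = d) ∧
      S.length + n ≤ t ∧ t ≤ c * n := by
  have hck : 2 * c ≤ c * k := by nlinarith
  set u := c * k with hu
  obtain ⟨S₁, n₁, h1, h2, -, h3, h4⟩ := hπ.exists_clean (ω := ω) (r := u - (c - 1)) (m := c - 1)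
    (x := x) (by omega) (by omega) (by omega) (by omega)
    (fun w hw hw' => hx w (by omega) (by omega))
    (fun i j hi hij hj => hinj _ _ (by omega) (by omega) (by omega) (by omega))
  have hur : u - (c - 1) + (c - 1) = u := by omega
  rw [hur] at h1 h3 h4
  have h4 := h4 hlin (fun w hw => by
    rw [hx w (by omega) (by omega)]
    exact hinj _ _ (by omega) (by omega) (by omega) (by omega))
  set ω₁ := playMoves G ω S₁ with hω₁
  -- The first sweep left layers from `u` on unchanged, so the rainbow layers needed by the
  -- reflected sweep are intact. The second sweep ends in the same colour `x u`, hence does not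
  -- spoil the cleaned part.
  obtain ⟨S₂, n₂, k1, k2, k3, k4, -⟩ := hπ.reflect.exists_clean (ω := ω₁) (r := t - u - c)
    (m := c - 1) (x := fun i => x (t - 1 - i)) (by omega) (by omega) (by omega) (by omega)
    (fun w hw hw' => by
      have hwt := hπ.lt w
      rw [h4 w (by omega), hx w (by omega) (by omega)]
      congr 1
      omega)
    (fun i j hi hij hj => (hinj _ _ (by omega) (by omega) (by omega) (by omega)).symm)
  have hur' : t - u - c + (c - 1) = t - 1 - u := by omega
  have hlast : t - 1 - (t - u - c + (c - 1)) = u := by omega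
  simp only [hlast] at k3 k4
  rw [hur'] at k1 k4
  refine ⟨S₁ ++ S₂, x u, n₁ + n₂ + 1, fun w => ?_, ?_, ?_⟩
  · rw [playMoves_append]
    rcases Nat.lt_or_ge (π w) u with h | h
    · rcases k3 w with h' | h'
      · exact h'
      · exact h'.trans (h3 w h.le)
    · exact k4 w (by omega)
  · simp only [List.length_append]
    omega
  -- The bound `c * k - (c - 1) ≤ c * n₁` rounds up to `k ≤ n₁`; this is why the meeting layer has
  -- index `c * k`.
  · have hn1 : k ≤ n₁ := by
      by_contra hcon
      have : c * (n₁ + 1) ≤ c * k := Nat.mul_le_mul_left c (by omega)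
      rw [mul_add] at this
      omega
    have : c * k ≤ c * n₁ := Nat.mul_le_mul_left c hn1
    rw [mul_add, mul_add]
    omega

theorem Layered.exists_moves (hπ : Layered G t π)
    (hG : (∀ u v, G.Adj u v → π v ≤ π u + 1) ∨ ∀ u v, π u + 1 = t → π v = 0 → G.Adj u v)
    (hc : 1 ≤ c) (ht : 2 * c ^ 10 ≤ t) (ω : V → Fin c) :
    ∃ (S : List (V × Fin c)) (d : Fin c) (n : ℕ), (∀ w, playMoves G ω S w = d) ∧
      S.length + n ≤ t ∧ t ≤ c * n := by
  rcases hc.eq_or_lt with rfl | hc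
  · exact ⟨[], 0, t, fun w => Subsingleton.elim _ _, by simp, by simp⟩
  -- Room for `c ^ 2` windows of `3 * c` layers, one further window and a small margin.
  have ht' : 3 * c * c ^ 2 + 3 * c + 3 ≤ t := by
    have h7 : 2 ^ 7 ≤ c ^ 7 := Nat.pow_le_pow_left hc 7
    have h3 : c ≤ c ^ 3 := Nat.le_self_pow (by norm_num) c
    have h10 : c ^ 10 = c ^ 3 * c ^ 7 := by ring
    have h3' : 3 * c * c ^ 2 = 3 * c ^ 3 := by ring
    nlinarith
  have hrep : ∀ i < t, ∃ a v, π v = i ∧ ω v = a := fun i hi => by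
    obtain ⟨v, hv⟩ := hπ.surj i hi
    exact ⟨_, v, hv, rfl⟩
  have : Nonempty (Fin c) := ⟨⟨0, by omega⟩⟩
  choose! x₀ hx₀ using hrep
  rcases exists_arcs_or_rainbow_of_le (fun i a => ∃ v, π v = i ∧ ω v = a) hx₀ (c ^ 2)
    (by omega) with ⟨x, q, s, hx, hq, hs, hqs⟩ | ⟨x, p, hp, -, hinj, hsing⟩
  · set k := (t - 1 - q) / c with hk
    have hk1 : c * k + (t - 1 - q) % c = t - 1 - q := Nat.div_add_mod _ _
    have hk2 : (t - 1 - q) % c < c := Nat.mod_lt _ (by omega)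
    have hkc : k * c = c * k := mul_comm _ _
    obtain ⟨S, d, hS, hlen⟩ := hπ.exists_moves_of_arcs (by omega) hx
      ((hs.trans (Arcs.of_colours x q k)).mono le_rfl (by omega : q + k * c ≤ t - 1))
    have hcc : c * (c - 1) + c = c ^ 2 := by
      obtain ⟨e, rfl⟩ : ∃ e, c = e + 1 := ⟨c - 1, by omega⟩
      simp only [Nat.add_sub_cancel]
      ring
    -- The surplus `c ^ 2` in `c * s` splits as `c * (c - 1)` for the final `c - 1` moves plus `c`
    -- for the layers lost in rounding to `k`.
    have hsk : c - 1 ≤ s + k := by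
      by_contra hcon
      have : c * (s + k) ≤ c * (c - 1) := Nat.mul_le_mul_left c (by omega)
      rw [mul_add] at this
      omega
    refine ⟨S, d, s + k - (c - 1), hS, by omega, ?_⟩
    rw [Nat.mul_sub, mul_add]
    omega
  · have hsing' : ∀ w, p < π w → π w < p + 3 * c → ω w = x (π w) := fun w h h' =>
      hsing _ _ h h' ⟨w, rfl, rfl⟩
    rcases hG with hlin | hcl
    -- Then `p + c < c * k ≤ p + 2 * c`, so the layers within distance `c` below and `c - 1` above
    -- `c * k` lie in the window and avoid its exceptional layer `p`.
    · set k := (p + 2 * c) / c with hk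
      have hk1 : c * k + (p + 2 * c) % c = p + 2 * c := Nat.div_add_mod _ _
      have hk2 : (p + 2 * c) % c < c := Nat.mod_lt _ (by omega)
      have hk3 : 2 ≤ k := (Nat.le_div_iff_mul_le (by omega)).2 (by omega)
      exact hπ.exists_moves_of_linear hlin hc (x := x) hk3 (by omega)
        (fun w h h' => hsing' w (by omega) (by omega))
        (fun i j h h' h1 h2 => hinj i j (by omega) h' h1 (by omega))
    · exact hπ.exists_moves_of_cyclic hcl hc (x := x) (p := p + 1) (by omega) (by omega)
        (fun w h h' => hsing' w (by omega) (by omega))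
        (fun i j h h' h1 => hinj i j (by omega) h' (by omega) (by omega))

theorem Layered.le_minMoves (hπ : Layered G t π) (ht : 1 ≤ t) (hc : 2 ≤ c) :
    ((t - 1 - (t - 1) / c : ℕ) : ℕ∞) ≤
      minMoves G fun v => (⟨π v % c, Nat.mod_lt _ (by omega)⟩ : Fin c) := by
  refine FloodIt.le_minMoves fun S d hS => ?_
  obtain ⟨f, col, hnc, hcol, hcard⟩ := hπ.exists_labelling S d _ hS
  have hres : ∀ i < t, (col (f i) : ℕ) = i % c := fun i hi => by
    obtain ⟨v, hv, e⟩ := hcol i hi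
    rw [← e, ← hv]
  have := le_card_image_add hc f t 0 ht
    (fun i j _ hij hj e => by
      have h := hres i (by omega)
      rw [e, hres j (by omega)] at h
      obtain ⟨k, hk⟩ := (Nat.modEq_iff_dvd' hij.le).1 h.symm
      exact ⟨k, by omega⟩)
    (fun i j k l _ h1 h2 h3 h4 => hnc i j k l h1 h2 h3 (by omega))
  rw [zero_add, ← Finset.range_eq_Ico] at this
  omega

theorem ceil_div_le {n : ℕ} (hc : 1 ≤ c) (h : t ≤ c * n) : ⌈(t : ℚ) / (c : ℚ)⌉₊ ≤ n := by
  have hc' : (0 : ℚ) < c := by exact_mod_cast hc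
  rw [Nat.ceil_le, div_le_iff₀ hc', mul_comm]
  exact_mod_cast h

theorem div_lt_ceil (hc : 1 ≤ c) (ht : 1 ≤ t) : (t - 1) / c < ⌈(t : ℚ) / (c : ℚ)⌉₊ := by
  have hc' : (0 : ℚ) < c := by exact_mod_cast hc
  rw [Nat.lt_ceil, lt_div_iff₀ hc']
  have := Nat.div_mul_le_self (t - 1) c
  exact_mod_cast (by omega : (t - 1) / c * c < t)

theorem Layered.maxMoves_eq (hπ : Layered G t π)
    (hG : (∀ u v, G.Adj u v → π v ≤ π u + 1) ∨ ∀ u v, π u + 1 = t → π v = 0 → G.Adj u v)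
    (hc : 1 ≤ c) (ht : 2 * c ^ 10 ≤ t) :
    maxMoves c G = ((t - ⌈(t : ℚ) / (c : ℚ)⌉₊ : ℕ) : ℕ∞) := by
  have hct : c ≤ t := by
    have : c ≤ c ^ 10 := Nat.le_self_pow (by norm_num) c
    omega
  refine le_antisymm (iSup_le fun ω => ?_) ?_
  · obtain ⟨S, d, n, hS, h1, h2⟩ := hπ.exists_moves hG hc ht ω.1
    refine (minMoves_le S hS).trans ?_
    have := ceil_div_le hc h2
    exact_mod_cast (by omega : S.length ≤ t - ⌈(t : ℚ) / (c : ℚ)⌉₊)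
  · rcases hc.eq_or_lt with rfl | hc
    · simp
    · refine le_trans ?_ (le_iSup_of_le ⟨fun v => ⟨π v % c, Nat.mod_lt _ (by omega)⟩, ?_⟩
        (hπ.le_minMoves (by omega) hc))
      · have := div_lt_ceil (c := c) (t := t) hc.le (by omega)
        exact_mod_cast (by omega : t - ⌈(t : ℚ) / (c : ℚ)⌉₊ ≤ t - 1 - (t - 1) / c)
      · intro a
        obtain ⟨v, hv⟩ := hπ.surj a (a.2.trans_le hct)
        exact ⟨v, Fin.ext (by simp only [hv]; exact Nat.mod_eq_of_lt a.2)⟩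

end Upper

end FloodIt

theorem mainTheorem1 {V : Type*} [Finite V] (G : SimpleGraph V) (c t : ℕ) (hc : 1 ≤ c)
    (ht : 2 * c ^ 10 ≤ t)
    (hG : FloodIt.IsBlowUp G (SimpleGraph.pathGraph t) ∨
      (3 ≤ t ∧ FloodIt.IsBlowUp G (SimpleGraph.cycleGraph t))) :
    FloodIt.maxMoves c G = ((t - ⌈(t : ℚ) / (c : ℚ)⌉₊ : ℕ) : ℕ∞) := by
  rcases hG with ⟨π, hsurj, hadj⟩ | ⟨ht3, π, hsurj, hadj⟩
  · have hadj' : ∀ u v, G.Adj u v ↔ (π u : ℕ) + 1 = π v ∨ (π v : ℕ) + 1 = π u := fun u v => by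
      rw [hadj, SimpleGraph.pathGraph_adj]
    refine FloodIt.Layered.maxMoves_eq (π := fun v => (π v : ℕ)) ⟨fun v => (π v).2, ?_, ?_, ?_⟩
      (Or.inl ?_) hc ht
    · intro i hi
      obtain ⟨v, hv⟩ := hsurj ⟨i, hi⟩
      exact ⟨v, by simp [hv]⟩
    · intro u v h
      exact (hadj' u v).2 (Or.inl h.symm)
    · intro u v h
      have := (hadj' u v).1 h
      omega
    · intro u v h
      have := (hadj' u v).1 h
      omega
  · have hadj' : ∀ u v, G.Adj u v ↔ ((π v : ℕ) = π u + 1 ∨ (π u : ℕ) = π v + 1 ∨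
        ((π u : ℕ) = 0 ∧ (π v : ℕ) + 1 = t) ∨ ((π v : ℕ) = 0 ∧ (π u : ℕ) + 1 = t)) := fun u v => by
      have hu := (π u).2
      have hv := (π v).2
      rw [hadj, SimpleGraph.cycleGraph_adj']
      -- Adjacency in the cycle is stated through subtraction modulo `t`, whose value depends on the
      -- order of the two indices.
      rcases lt_trichotomy (π u) (π v) with h | h | h
      · rw [Fin.coe_sub_iff_lt.2 h, Fin.coe_sub_iff_le.2 h.le]
        rw [Fin.lt_def] at h
        omega
      · rw [h, Fin.coe_sub_iff_le.2 le_rfl]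
        omega
      · rw [Fin.coe_sub_iff_lt.2 h, Fin.coe_sub_iff_le.2 h.le]
        rw [Fin.lt_def] at h
        omega
    refine FloodIt.Layered.maxMoves_eq (π := fun v => (π v : ℕ)) ⟨fun v => (π v).2, ?_, ?_, ?_⟩
      (Or.inr ?_) hc ht
    · intro i hi
      obtain ⟨v, hv⟩ := hsurj ⟨i, hi⟩
      exact ⟨v, by simp [hv]⟩
    · intro u v h
      exact (hadj' u v).2 (Or.inl h)
    · intro u v h
      exact (hadj' u v).1 h
    · intro u v h h'
      exact (hadj' u v).2 (Or.inr (Or.inr (Or.inr ⟨h', h⟩)))
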